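/- Let $m,d\ge 1$, let $\mathbb S^d$ be the unit sphere of $\mathbb R^{d+1}$ with spherical distance $\vartheta(\mathbf x,\mathbf y)=\arccos(\mathbf x'\mathbf y)$, and let $\mathbb T$ be $\mathbb R$ or $\mathbb Z$. Let $\{\mathbf Z(\mathbf x;t):\mathbf x\in\mathbb S^d,\ t\in\mathbb T\}$ be an $\mathbb R^m$-valued random field with finite second-order moments that is isotropic on $\mathbb S^d$ and stationary on $\mathbb T$ in the wide sense, that is, its mean is constant and its covariance matrix function is of the form $$\operatorname{cov}(\mathbf Z(\mathbf x_1;t_1),\mathbf Z(\mathbf x_2;t_2))=\mathbf C(\vartheta(\mathbf x_1,\mathbf x_2);\,t_1-t_2),\qquad \mathbf x_1,\mathbf x_2\in\mathbb S^d,\ t_1,t_2\in\mathbb T.$$ Suppose also that it is mean square continuous over $\mathbb S^d$: for every $t\in\mathbb T$ and $\mathbf x_0\in\mathbb S^d$, $\mathrm E\|\mathbf Z(\mathbf x;t)-\mathbf Z(\mathbf x_0;t)\|^2\to 0$ as $\mathbf x\to\mathbf x_0$. For $\lambda>0$ let $P_n^{(\lambda)}$ be the Gegenbauer polynomials: $P_0^{(\lambda)}(x)=1$,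 $P_1^{(\lambda)}(x)=2\lambda x$ and $nP_n^{(\lambda)}(x)=2(\lambda+n-1)xP_{n-1}^{(\lambda)}(x)-(2\lambda+n-2)P_{n-2}^{(\lambda)}(x)$ for $n\ge 2$. Then there are $m\times m$ real matrix functions $\mathbf B_n(t)$, $n\in\mathbb N_0$, $t\in\mathbb T$, such that, for all $\vartheta\in[0,\pi]$ and $t\in\mathbb T$, $$\frac{\mathbf C(\vartheta;t)+\mathbf C(\vartheta;-t)}{2}=\begin{cases}\displaystyle\sum_{n=0}^\infty \mathbf B_n(t)\cos(n\vartheta), & d=1,\\[2ex] \displaystyle\sum_{n=0}^\infty \mathbf B_n(t)\,P_n^{\left(\frac{d-1}{2}\right)}(\cos\vartheta), & d\ge 2.\end{cases}$$ For each fixed $t\in\mathbb T$ the matrices $\mathbf B_n(t)$ are symmetric and $\sum_{n=0}^\infty\mathbf B_n(t)$ (if $d=1$), respectively $\sum_{n=0}^\infty\mathbf B_n(t)P_n^{\left(\frac{d-1}{2}\right)}(1)$ (if $d\ge 2$), converges. For each fixed $n\in\mathbb N_0$, $\mathbf B_n$ is a stationary covariance matrix function on $\mathbb T$, that is, there is a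 wide-sense stationary $\mathbb R^m$-valued process $\{\mathbf W(t):t\in\mathbb T\}$ with finite second-order moments, on some probability space, with $\operatorname{cov}(\mathbf W(t_1),\mathbf W(t_2))=\mathbf B_n(t_1-t_2)$ for all $t_1,t_2\in\mathbb T$. In particular, if $\mathbf C(\vartheta;-t)=\mathbf C(\vartheta;t)$ for all $\vartheta\in[0,\pi]$ and $t\in\mathbb T$, then $\mathbf C(\vartheta;t)$ itself equals the series above for all $\vartheta\in[0,\pi]$ and $t\in\mathbb T$. -/

import Mathlib

open MeasureTheory ProbabilityTheory Filter Topology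

universe u v

noncomputable section

/-- The unit sphere `S^d` of `ℝ^(d+1)`. -/
abbrev UnitSphere (d : ℕ) : Type :=
  Metric.sphere (0 : EuclideanSpace ℝ (Fin (d + 1))) 1

/-- The spherical (geodesic) distance `ϑ(x, y) = arccos (x'y)`. -/
def sphericalDist {d : ℕ} (x y : UnitSphere d) : ℝ :=
  Real.arccos (inner ℝ (x : EuclideanSpace ℝ (Fin (d + 1))) (y : EuclideanSpace ℝ (Fin (d + 1))))

/-- The ultraspherical (Gegenbauer) polynomials `P_n^{(lam)}(x)`, by the three-term recurrence. -/
def gegenbauer (lam : ℝ) : ℕ → ℝ → ℝ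
  | 0, _ => 1
  | 1, x => 2 * lam * x
  | n + 2, x =>
      (2 * (lam + (n + 2 : ℝ) - 1) * x * gegenbauer lam (n + 1) x
        - (2 * lam + (n + 2 : ℝ) - 2) * gegenbauer lam n x) / (n + 2 : ℝ)

/-- The elementary function of degree `n` in the expansion on `S^d`: `cos (n ϑ)` when `d = 1`, and
`P_n^{((d-1)/2)}(cos ϑ)` when `d ≥ 2`. -/
def zonal (d n : ℕ) (ϑ : ℝ) : ℝ :=
  if d = 1 then Real.cos (n * ϑ) else gegenbauer (((d : ℝ) - 1) / 2) n (Real.cos ϑ)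

/-- The covariance matrix `E {(X - E X) (Y - E Y)'}` of two random vectors. -/
def covMatrix {Ω : Type u} [MeasurableSpace Ω] {m : ℕ} (P : Measure Ω)
    (X Y : Ω → EuclideanSpace ℝ (Fin m)) : Matrix (Fin m) (Fin m) ℝ :=
  Matrix.of fun i j => covariance (fun ω => X ω i) (fun ω => Y ω j) P

/-- A random vector with finite second-order moments. -/
def IsSecondOrder {Ω : Type u} [MeasurableSpace Ω] {m : ℕ} (P : Measure Ω)
    (X : Ω → EuclideanSpace ℝ (Fin m)) : Prop :=
  Measurable X ∧ MemLp X 2 P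

/-- An `m`-variate second-order random field on `S^d × T` that is (wide-sense) isotropic over `S^d`
and (wide-sense) stationary over `T`: the mean is constant, and the covariance matrix depends
only on the spherical distance of the two points and on the time lag. -/
structure IsIsotropicStationary {Ω : Type u} [MeasurableSpace Ω] {d m : ℕ} {T : Type v}
    [AddCommGroup T] (P : Measure Ω)
    (Z : UnitSphere d → T → Ω → EuclideanSpace ℝ (Fin m)) : Prop where
  secondOrder : ∀ x t, IsSecondOrder P (Z x t)
  mean_const : ∃ μ : EuclideanSpace ℝ (Fin m), ∀ x t, ∫ ω, Z x t ω ∂P = μ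
  cov_invariant : ∀ (x₁ x₂ y₁ y₂ : UnitSphere d) (t₁ t₂ s₁ s₂ : T),
    sphericalDist x₁ x₂ = sphericalDist y₁ y₂ → t₁ - t₂ = s₁ - s₂ →
      covMatrix P (Z x₁ t₁) (Z x₂ t₂) = covMatrix P (Z y₁ s₁) (Z y₂ s₂)

/-- Mean square continuity over the sphere, at every fixed time. -/
def IsMeanSquareContinuousOnSphere {Ω : Type u} [MeasurableSpace Ω] {d m : ℕ} {T : Type v}
    (P : Measure Ω) (Z : UnitSphere d → T → Ω → EuclideanSpace ℝ (Fin m)) : Prop :=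
  ∀ (t : T) (x₀ : UnitSphere d),
    Tendsto (fun x => ∫ ω, ‖Z x t ω - Z x₀ t ω‖ ^ 2 ∂P) (𝓝 x₀) (𝓝 0)

/-- `C (ϑ; t)`, `0 ≤ ϑ ≤ π`, is the covariance matrix function of the field `Z`. -/
def IsCovMatrixFunction {Ω : Type u} [MeasurableSpace Ω] {d m : ℕ} {T : Type v}
    [AddCommGroup T] (P : Measure Ω) (Z : UnitSphere d → T → Ω → EuclideanSpace ℝ (Fin m))
    (C : ℝ → T → Matrix (Fin m) (Fin m) ℝ) : Prop :=
  ∀ (x₁ x₂ : UnitSphere d) (t₁ t₂ : T),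
    covMatrix P (Z x₁ t₁) (Z x₂ t₂) = C (sphericalDist x₁ x₂) (t₁ - t₂)

/-- `B` is a stationary covariance matrix function on `T`: it is the covariance matrix function of
some `m`-variate second-order (wide-sense) stationary process on `T`. -/
def IsStationaryCovMatrixFunction {m : ℕ} {T : Type v} [AddCommGroup T]
    (B : T → Matrix (Fin m) (Fin m) ℝ) : Prop :=
  ∃ (Ω : Type u) (_ : MeasurableSpace Ω) (P : Measure Ω) (_ : IsProbabilityMeasure P)
    (W : T → Ω → EuclideanSpace ℝ (Fin m)),
    (∀ t, IsSecondOrder P (W t)) ∧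
    (∃ μ : EuclideanSpace ℝ (Fin m), ∀ t, ∫ ω, W t ω ∂P = μ) ∧
    ∀ t₁ t₂, covMatrix P (W t₁) (W t₂) = B (t₁ - t₂)

end

/-! The centred coordinates of the field are continuous maps `Y` from the sphere to the Hilbert
space L²(P), and their inner products are the entries of C(arccos⟨x,y⟩; t-s). Averaging `Y` against
the zonal polynomial p_n(⟨pole,x⟩) gives, after scaling, a vector W_n(t). By the Funk–Hecke formula
its Gram matrix ⟨W_n(t)_i, W_n(s)_j⟩ is A_n(t-s)_ij, where A_n(t) collects the n-th zonal
coefficients of C(·;t). So each A_n is a covariance by construction (`inner_component`), and no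
positive-definiteness criterion is needed. For one coordinate, the W_n of different degrees are
orthogonal. Bessel's inequality against `Y (pole d)` makes the diagonal coefficients times p_n(1)
summable, and Cauchy–Schwarz extends this to all entries. Since |p_n| ≤ p_n(1) on [-1,1], the zonal
series converges uniformly, and Weierstrass approximation identifies its sum with C
(`hasSum_zonal`). Finally B_n(t) = (A_n(t) + A_n(-t))/2 is realised by adding to W_n an independent
time-reversed copy. It is symmetric because C(ϑ;-t) is the transpose of C(ϑ;t). The harmonic
analysis uses rotation invariance only. The density of the zonal measure is never computed: moment
recurrences give integration by parts, the differential equation of p_n then gives orthogonality,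
and Funk–Hecke follows because zonal convolution is symmetric and does not raise the degree. -/

/-- The ambient space of the sphere `S^d`. -/
abbrev Ambient (d : ℕ) : Type := EuclideanSpace ℝ (Fin (d + 1))

/-- The (unnormalised) surface measure of `S^d`. -/
noncomputable abbrev surface (d : ℕ) : Measure (UnitSphere d) :=
  (volume : Measure (Ambient d)).toSphere

/-! ### Rotation invariance of the surface measure -/

/-- The action of a linear isometry on the sphere. -/
noncomputable def sphereMap {d : ℕ} (U : Ambient d ≃ₗᵢ[ℝ] Ambient d) (y : UnitSphere d) : UnitSphere d :=
  ⟨U y, by simp⟩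

lemma continuous_sphereMap {d : ℕ} (U : Ambient d ≃ₗᵢ[ℝ] Ambient d) :
    Continuous (sphereMap U) :=
  (U.continuous.comp continuous_subtype_val).subtype_mk _

lemma injective_sphereMap {d : ℕ} (U : Ambient d ≃ₗᵢ[ℝ] Ambient d) :
    Function.Injective (sphereMap U) := by
  intro x y h
  apply Subtype.ext
  apply U.injective
  exact congrArg Subtype.val h

/-- The surface measure of a set is, up to a constant, the volume of the cone over it. Taking cones
commutes with `U`, and `U` preserves volume. -/
lemma measurePreserving_sphereMap {d : ℕ} (U : Ambient d ≃ₗᵢ[ℝ] Ambient d) :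
    MeasurePreserving (sphereMap U) (surface d) (surface d) := by
  refine ⟨(continuous_sphereMap U).measurable, ?_⟩
  ext s hs
  rw [Measure.map_apply (continuous_sphereMap U).measurable hs, Measure.toSphere_apply' _ hs,
    Measure.toSphere_apply' _ ((continuous_sphereMap U).measurable hs)]
  congr 1
  symm
  rw [← U.measurePreserving.measure_preimage_emb U.toHomeomorph.measurableEmbedding]
  congr 1
  ext z
  simp only [Set.mem_smul, Set.mem_image, Set.mem_preimage]
  refine Iff.symm ⟨?_, ?_⟩
  · rintro ⟨r, hr, w, ⟨y, hy, rfl⟩, rfl⟩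
    exact ⟨r, hr, _, ⟨sphereMap U y, hy, rfl⟩, by simp [sphereMap]⟩
  · rintro ⟨r, hr, w, ⟨y, hy, rfl⟩, h⟩
    have key : sphereMap U (sphereMap U.symm y) = y := Subtype.ext (by simp [sphereMap])
    refine ⟨r, hr, _, ⟨sphereMap U.symm y, by rw [key]; exact hy, rfl⟩, ?_⟩
    apply U.injective
    rw [← h]
    simp [sphereMap]

lemma integral_comp_isometry {d : ℕ} (U : Ambient d ≃ₗᵢ[ℝ] Ambient d) (F : Ambient d → ℝ) :
    ∫ y, F (U y) ∂(surface d) = ∫ y, F y ∂(surface d) :=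
  (measurePreserving_sphereMap U).integral_comp
    ((continuous_sphereMap U).measurableEmbedding (injective_sphereMap U)) fun y => F y

lemma continuous_integrable_of_compact {X E : Type*} [TopologicalSpace X] [CompactSpace X]
    [MeasurableSpace X] [OpensMeasurableSpace X] [NormedAddCommGroup E]
    [SecondCountableTopologyEither X E] {ν : Measure X}
    [IsFiniteMeasure ν] {f : X → E} (hf : Continuous f) : Integrable f ν :=
  hf.integrable_of_hasCompactSupport (HasCompactSupport.of_compactSpace f)

/-! ### Orthonormal pairs -/

/-- Two orthogonal unit vectors. -/
structure OrthoPair {d : ℕ} (x u : Ambient d) : Prop where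
  left : ‖x‖ = 1
  right : ‖u‖ = 1
  ortho : inner ℝ x u = 0

lemma OrthoPair.exists_basis {d : ℕ} (hd : 1 ≤ d) {x u : Ambient d} (h : OrthoPair x u) :
    ∃ b : OrthonormalBasis (Fin (d + 1)) ℝ (Ambient d), b 0 = x ∧ b (Fin.last d) = u := by
  have hne : (Fin.last d) ≠ 0 := by
    intro h0
    have := congrArg Fin.val h0
    simp at this
    omega
  have hv : Orthonormal ℝ (({0, Fin.last d} : Set (Fin (d + 1))).domRestrict
      fun i => if i = 0 then x else u) := by
    constructor
    · rintro ⟨i, hi⟩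
      change ‖if i = 0 then x else u‖ = 1
      split_ifs
      exacts [h.left, h.right]
    · rintro ⟨i, hi⟩ ⟨j, hj⟩ hij
      replace hij : i ≠ j := fun h => hij (Subtype.ext h)
      change inner ℝ (if i = 0 then x else u) (if j = 0 then x else u) = 0
      rcases (hi : i = 0 ∨ i = Fin.last d) with rfl | rfl <;>
        rcases (hj : j = 0 ∨ j = Fin.last d) with rfl | rfl
      · exact absurd rfl hij
      · simpa [hne] using h.ortho
      · simpa [hne, real_inner_comm] using h.ortho
      · exact absurd rfl hij
  obtain ⟨b, hb⟩ := hv.exists_orthonormalBasis_extension_of_card_eq (by simp)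
  refine ⟨b, ?_, ?_⟩
  · simpa using hb 0 (by simp)
  · simpa [hne] using hb (Fin.last d) (by simp)

lemma OrthoPair.exists_isometry {d : ℕ} (hd : 1 ≤ d) {x u x' u' : Ambient d}
    (h : OrthoPair x u) (h' : OrthoPair x' u') :
    ∃ U : Ambient d ≃ₗᵢ[ℝ] Ambient d, U x = x' ∧ U u = u' := by
  obtain ⟨b, rfl, rfl⟩ := h.exists_basis hd
  obtain ⟨b', rfl, rfl⟩ := h'.exists_basis hd
  exact ⟨b.repr.trans b'.repr.symm, by simp, by simp⟩

lemma exists_orthoPair {d : ℕ} (hd : 1 ≤ d) {x : Ambient d} (hx : ‖x‖ = 1) :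
    ∃ u, OrthoPair x u := by
  have hv : Orthonormal ℝ (({0} : Set (Fin (d + 1))).domRestrict fun _ => x) := by
    constructor
    · exact fun _ => hx
    · rintro ⟨i, hi⟩ ⟨j, hj⟩ hij
      exact absurd (Subtype.ext ((Set.mem_singleton_iff.1 hi).trans
        (Set.mem_singleton_iff.1 hj).symm)) hij
  obtain ⟨b, hb⟩ := hv.exists_orthonormalBasis_extension_of_card_eq (by simp)
  have hne : (0 : Fin (d + 1)) ≠ Fin.last d := by
    intro h0
    have := congrArg Fin.val h0
    simp at this
    omega
  have h0 : b 0 = x := hb 0 (by simp)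
  exact ⟨b (Fin.last d), hx, b.orthonormal.1 _, by rw [← h0]; exact b.orthonormal.2 hne⟩

/-- Gram–Schmidt, with `u` arbitrary when e = ±x. Only r² is recorded, since odd powers of r will
integrate to zero. -/
lemma exists_orthoPair_decomposition {d : ℕ} (hd : 1 ≤ d) {x e : Ambient d} (hx : ‖x‖ = 1)
    (he : ‖e‖ = 1) : ∃ (u : Ambient d) (r : ℝ), OrthoPair x u ∧
      e = (inner ℝ x e : ℝ) • x + r • u ∧ r ^ 2 = 1 - (inner ℝ x e : ℝ) ^ 2 := by
  set s : ℝ := inner ℝ x e with hs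
  set w := e - s • x with hw
  have hxx : inner ℝ x x = (1 : ℝ) := by rw [real_inner_self_eq_norm_sq, hx]; norm_num
  have hee : inner ℝ e e = (1 : ℝ) := by rw [real_inner_self_eq_norm_sq, he]; norm_num
  have hxw : inner ℝ x w = (0 : ℝ) := by
    rw [hw, inner_sub_right, inner_smul_right, hxx, ← hs]; ring
  have hww : ‖w‖ ^ 2 = 1 - s ^ 2 := by
    rw [← real_inner_self_eq_norm_sq, hw, inner_sub_sub_self, hee, inner_smul_left,
      inner_smul_right, inner_smul_left, inner_smul_right, hxx, real_inner_comm x e, ← hs]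
    simp; ring
  by_cases h0 : w = 0
  · obtain ⟨u, hu⟩ := exists_orthoPair hd hx
    refine ⟨u, 0, hu, ?_, ?_⟩
    · rw [zero_smul, add_zero]; exact sub_eq_zero.1 h0
    · rw [← hww, h0]; simp
  · have hn : ‖w‖ ≠ 0 := norm_ne_zero_iff.2 h0
    refine ⟨‖w‖⁻¹ • w, ‖w‖, ⟨hx, ?_, ?_⟩, ?_, hww⟩
    · rw [norm_smul, norm_inv, norm_norm, inv_mul_cancel₀ hn]
    · rw [inner_smul_right, hxw, mul_zero]
    · rw [smul_smul, mul_inv_cancel₀ hn, one_smul, hw]; abel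

/-! ### The zonal measure -/

/-- A fixed pole of the sphere. -/
noncomputable def pole (d : ℕ) : UnitSphere d := ⟨EuclideanSpace.single 0 1, by simp⟩

/-- The law of the inner product with the pole under the surface measure. -/
noncomputable def zonalMeasure (d : ℕ) : Measure ℝ :=
  (surface d).map fun y : UnitSphere d => inner ℝ (pole d : Ambient d) (y : Ambient d)

lemma continuous_inner_sphere {d : ℕ} (x : Ambient d) :
    Continuous fun y : UnitSphere d => (inner ℝ x (y : Ambient d) : ℝ) := by fun_prop

instance (d : ℕ) : IsFiniteMeasure (zonalMeasure d) := by
  unfold zonalMeasure; infer_instance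

lemma norm_sphere {d : ℕ} (y : UnitSphere d) : ‖(y : Ambient d)‖ = 1 := by simp

lemma integral_zonal {d : ℕ} (hd : 1 ≤ d) {f : ℝ → ℝ} (hf : Continuous f) {x : Ambient d}
    (hx : ‖x‖ = 1) :
    ∫ y : UnitSphere d, f (inner ℝ x (y : Ambient d)) ∂(surface d) = ∫ s, f s ∂(zonalMeasure d) := by
  rw [zonalMeasure, integral_map (continuous_inner_sphere _).aemeasurable
    hf.aestronglyMeasurable]
  obtain ⟨u, hu⟩ := exists_orthoPair hd hx
  obtain ⟨u', hu'⟩ := exists_orthoPair hd (norm_sphere (pole d))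
  obtain ⟨U, h1, -⟩ := hu'.exists_isometry hd hu
  rw [← integral_comp_isometry U fun y => f (inner ℝ x y)]
  simp [← h1]

lemma Continuous.integrable_zonalMeasure {d : ℕ} {f : ℝ → ℝ} (hf : Continuous f) :
    Integrable f (zonalMeasure d) := by
  rw [zonalMeasure, integrable_map_measure hf.aestronglyMeasurable
    (continuous_inner_sphere _).aemeasurable]
  exact continuous_integrable_of_compact (hf.comp (continuous_inner_sphere _))

lemma abs_inner_sphere_le {d : ℕ} (x y : UnitSphere d) :
    |(inner ℝ (x : Ambient d) (y : Ambient d) : ℝ)| ≤ 1 := by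
  simpa using abs_real_inner_le_norm (x : Ambient d) (y : Ambient d)

lemma inner_sphere_mem_Icc {d : ℕ} (x y : UnitSphere d) :
    (inner ℝ (x : Ambient d) (y : Ambient d) : ℝ) ∈ Set.Icc (-1 : ℝ) 1 :=
  abs_le.1 (abs_inner_sphere_le x y)

lemma exists_inner_eq {d : ℕ} (hd : 1 ≤ d) (x : UnitSphere d) {s : ℝ} (hs : s ∈ Set.Icc (-1 : ℝ) 1) :
    ∃ y : UnitSphere d, inner ℝ (x : Ambient d) (y : Ambient d) = s := by
  obtain ⟨u, hu⟩ := exists_orthoPair hd (norm_sphere x)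
  have hxx : inner ℝ (x : Ambient d) x = (1 : ℝ) := by simp
  have huu : inner ℝ u u = (1 : ℝ) := by rw [real_inner_self_eq_norm_sq, hu.right]; norm_num
  have hr : √(1 - s ^ 2) ^ 2 = 1 - s ^ 2 := Real.sq_sqrt (by nlinarith [hs.1, hs.2])
  refine ⟨⟨s • x + √(1 - s ^ 2) • u, ?_⟩, ?_⟩
  · rw [mem_sphere_zero_iff_norm, ← sq_eq_sq₀ (norm_nonneg _) zero_le_one,
      ← real_inner_self_eq_norm_sq]
    rw [inner_add_add_self]
    rw [real_inner_comm (s • (x : Ambient d)) (√(1 - s ^ 2) • u)]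
    simp only [real_inner_smul_left, real_inner_smul_right, hxx, huu, hu.ortho]
    nlinarith
  · simp [inner_add_right, inner_smul_right, hu.ortho]

/-- The surface measure charges every nonempty open set, and ⟨pole,y⟩ takes every value in [-1,1].
-/
lemma forall_eq_zero_of_integral_sq_eq_zero {d : ℕ} (hd : 1 ≤ d) {f : ℝ → ℝ} (hf : Continuous f)
    (h : ∫ s, f s ^ 2 ∂(zonalMeasure d) = 0) {s : ℝ} (hs : s ∈ Set.Icc (-1 : ℝ) 1) : f s = 0 := by
  rw [← integral_zonal hd (f := fun s => f s ^ 2) (hf.pow 2) (norm_sphere (pole d))] at h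
  have hc : Continuous fun y : UnitSphere d =>
      f (inner ℝ (pole d : Ambient d) (y : Ambient d)) ^ 2 :=
    (hf.comp (continuous_inner_sphere _)).pow 2
  rw [integral_eq_zero_iff_of_nonneg (fun y => sq_nonneg _)
    (continuous_integrable_of_compact hc)] at h
  have h2 := (Continuous.ae_eq_iff_eq (surface d) hc continuous_const).1 h
  obtain ⟨y, hy⟩ := exists_inner_eq hd (pole d) hs
  have h3 : f (inner ℝ (pole d : Ambient d) (y : Ambient d)) ^ 2 = 0 := congrFun h2 y
  rw [hy] at h3
  exact pow_eq_zero_iff two_ne_zero |>.1 h3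

/-! ### Convolution with a zonal kernel does not raise the degree -/

/-- The integral of a function of `⟪x, y⟫` and `⟪u, y⟫` is the same for all orthonormal pairs
`(x, u)`. -/
lemma integral_orthoPair {d : ℕ} (hd : 1 ≤ d) (F : ℝ → ℝ → ℝ) {x u x' u' : Ambient d}
    (h : OrthoPair x u) (h' : OrthoPair x' u') :
    ∫ y : UnitSphere d, F (inner ℝ x (y : Ambient d)) (inner ℝ u (y : Ambient d)) ∂(surface d) =
      ∫ y : UnitSphere d, F (inner ℝ x' (y : Ambient d)) (inner ℝ u' (y : Ambient d))
        ∂(surface d) := by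
  obtain ⟨U, h1, h2⟩ := h.exists_isometry hd h'
  rw [← integral_comp_isometry U fun y => F (inner ℝ x' y) (inner ℝ u' y)]
  simp [← h1, ← h2]

/-- The reflection u ↦ -u preserves the integral and changes its sign. -/
lemma integral_orthoPair_odd {d : ℕ} (hd : 1 ≤ d) (φ : ℝ → ℝ) {j : ℕ} (hj : Odd j)
    {x u : Ambient d} (h : OrthoPair x u) :
    ∫ y : UnitSphere d, φ (inner ℝ x (y : Ambient d)) * (inner ℝ u (y : Ambient d) : ℝ) ^ j
      ∂(surface d) = 0 := by
  have h' : OrthoPair x (-u) := ⟨h.left, by rw [norm_neg, h.right], by simp [h.ortho]⟩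
  have h1 := integral_orthoPair hd (fun a b => φ a * b ^ j) h h'
  simp only [inner_neg_left, hj.neg_pow, mul_neg, integral_neg] at h1
  linarith

/-- Zonal convolution with a continuous function maps polynomials of degree at most `n` to
polynomials of degree at most `n`. -/
lemma exists_polynomial_convolution_pow {d : ℕ} (hd : 1 ≤ d) {φ : ℝ → ℝ} (hφ : Continuous φ)
    (n : ℕ) : ∃ k : Polynomial ℝ, k.natDegree ≤ n ∧ ∀ x e : UnitSphere d,
      ∫ y : UnitSphere d, φ (inner ℝ (x : Ambient d) (y : Ambient d)) *
        (inner ℝ (e : Ambient d) (y : Ambient d) : ℝ) ^ n ∂(surface d) =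
        k.eval (inner ℝ (x : Ambient d) (e : Ambient d)) := by
  obtain ⟨u₀, hu₀⟩ := exists_orthoPair hd (norm_sphere (pole d))
  set J : ℕ → ℝ := fun j => ∫ y : UnitSphere d, φ (inner ℝ (pole d : Ambient d) (y : Ambient d)) *
    (inner ℝ (pole d : Ambient d) (y : Ambient d) : ℝ) ^ (n - j) *
    (inner ℝ u₀ (y : Ambient d) : ℝ) ^ j ∂(surface d) with hJ
  -- Write e = s x + r u and expand ⟨e,y⟩^n binomially. Odd powers of r drop out, and r² = 1 - s²
  -- turns the even ones into polynomials in s.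
  refine ⟨∑ j ∈ Finset.range (n + 1), if Even j then
    Polynomial.C (n.choose j * J j) * Polynomial.X ^ (n - j) *
      (1 - Polynomial.X ^ 2) ^ (j / 2) else 0, ?_, ?_⟩
  · refine Polynomial.natDegree_sum_le_of_forall_le _ _ fun j hj => ?_
    have hjn : j ≤ n := Nat.lt_succ_iff.1 (Finset.mem_range.1 hj)
    split_ifs with hev
    · have h1 : (1 - Polynomial.X ^ 2 : Polynomial ℝ).natDegree ≤ 2 := by
        compute_degree
      have h2 := Polynomial.natDegree_pow_le_of_le (j / 2) h1
      have h3 : (Polynomial.C (n.choose j * J j) * Polynomial.X ^ (n - j)).natDegree ≤ n - j :=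
        Polynomial.natDegree_C_mul_X_pow_le _ _
      refine (Polynomial.natDegree_mul_le_of_le h3 h2).trans ?_
      omega
    · simp
  · intro x e
    obtain ⟨u, r, hu, he, hr⟩ := exists_orthoPair_decomposition hd (norm_sphere x) (norm_sphere e)
    set s : ℝ := inner ℝ (x : Ambient d) (e : Ambient d) with hs
    have hexp : ∀ y : UnitSphere d, φ (inner ℝ (x : Ambient d) (y : Ambient d)) *
        (inner ℝ (e : Ambient d) (y : Ambient d) : ℝ) ^ n =
        ∑ j ∈ Finset.range (n + 1), (s ^ (n - j) * r ^ j * n.choose j) *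
          (φ (inner ℝ (x : Ambient d) (y : Ambient d)) *
            (inner ℝ (x : Ambient d) (y : Ambient d) : ℝ) ^ (n - j) *
            (inner ℝ u (y : Ambient d) : ℝ) ^ j) := by
      intro y
      have : (inner ℝ (e : Ambient d) (y : Ambient d) : ℝ) =
          r * inner ℝ u (y : Ambient d) + s * inner ℝ (x : Ambient d) (y : Ambient d) := by
        rw [he, inner_add_left, real_inner_smul_left, real_inner_smul_left, add_comm]
      rw [this, add_pow, Finset.mul_sum]
      refine Finset.sum_congr rfl fun j _ => ?_
      ring
    simp only [hexp]
    rw [integral_finsetSum]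
    · rw [Polynomial.eval_finsetSum]
      refine Finset.sum_congr rfl fun j _ => ?_
      rw [integral_const_mul]
      split_ifs with hev
      · have h1 := integral_orthoPair hd (fun a b => φ a * a ^ (n - j) * b ^ j) hu hu₀
        rw [h1]
        obtain ⟨i, rfl⟩ := hev.two_dvd
        have h2 : 2 * i / 2 = i := by omega
        rw [pow_mul, hr, h2]
        simp [hJ]
        ring
      · have h1 := integral_orthoPair_odd hd (fun a => φ a * a ^ (n - j))
          (Nat.not_even_iff_odd.1 hev) hu
        rw [h1]
        simp
    · intro j _
      refine (continuous_integrable_of_compact ?_).const_mul _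
      fun_prop

lemma exists_polynomial_convolution {d : ℕ} (hd : 1 ≤ d) {φ : ℝ → ℝ} (hφ : Continuous φ)
    (q : Polynomial ℝ) : ∃ k : Polynomial ℝ, k.natDegree ≤ q.natDegree ∧ ∀ x e : UnitSphere d,
      ∫ y : UnitSphere d, φ (inner ℝ (x : Ambient d) (y : Ambient d)) *
        q.eval (inner ℝ (e : Ambient d) (y : Ambient d)) ∂(surface d) =
        k.eval (inner ℝ (x : Ambient d) (e : Ambient d)) := by
  choose k hk hint using exists_polynomial_convolution_pow hd hφ
  refine ⟨∑ n ∈ Finset.range (q.natDegree + 1), Polynomial.C (q.coeff n) * k n, ?_, ?_⟩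
  · refine Polynomial.natDegree_sum_le_of_forall_le _ _ fun n hn => ?_
    exact (Polynomial.natDegree_C_mul_le _ _).trans
      ((hk n).trans (Nat.lt_succ_iff.1 (Finset.mem_range.1 hn)))
  · intro x e
    simp only [Polynomial.eval_eq_sum_range (p := q), Finset.mul_sum, Polynomial.eval_finsetSum,
      Polynomial.eval_mul, Polynomial.eval_C]
    rw [integral_finsetSum]
    · refine Finset.sum_congr rfl fun n _ => ?_
      rw [← hint n x e, ← integral_const_mul]
      congr 1
      ext y
      ring
    · intro n _
      refine continuous_integrable_of_compact ?_
      fun_prop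

/-! ### Moments of the zonal measure and integration by parts -/

lemma OrthoPair.norm_smul_add {d : ℕ} {x u : Ambient d} (h : OrthoPair x u) (b : ℝ) :
    ‖x + b • u‖ ^ 2 = 1 + b ^ 2 := by
  rw [norm_add_sq_real, inner_smul_right, h.ortho, norm_smul, mul_pow, h.left, h.right]
  simp

/-- The integrand is ⟨x + b u, y⟩^(2p), and x + b u is a unit vector scaled by √(1 + b²). -/
lemma integral_even_moment_pencil {d : ℕ} (hd : 1 ≤ d) {x u : Ambient d} (h : OrthoPair x u)
    (p : ℕ) (b : ℝ) :
    ∫ y : UnitSphere d, ((inner ℝ x (y : Ambient d) : ℝ) + b * inner ℝ u (y : Ambient d)) ^ (2 * p)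
      ∂(surface d) = (1 + b ^ 2) ^ p * ∫ s, s ^ (2 * p) ∂(zonalMeasure d) := by
  have hn : ‖x + b • u‖ ≠ 0 := by
    intro h0
    have := h.norm_smul_add b
    rw [h0] at this
    nlinarith [sq_nonneg b]
  have h1 : ‖(‖x + b • u‖⁻¹ • (x + b • u) : Ambient d)‖ = 1 := by
    rw [norm_smul, norm_inv, norm_norm, inv_mul_cancel₀ hn]
  rw [← integral_zonal hd (f := fun s => s ^ (2 * p)) (by fun_prop) h1, ← h.norm_smul_add b,
    ← integral_const_mul]
  congr 1
  ext y
  rw [real_inner_smul_left, inner_add_left, real_inner_smul_left, mul_pow, ← pow_mul,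
    ← mul_assoc, ← mul_pow, mul_inv_cancel₀ hn, one_pow, one_mul]

/-- Mixed second moments from pure ones, by comparing coefficients of `b ^ 2`. -/
lemma integral_mixed_moment {d : ℕ} (hd : 1 ≤ d) {x u : Ambient d} (h : OrthoPair x u) (p : ℕ) :
    (2 * p + 1 : ℝ) * ∫ y : UnitSphere d, (inner ℝ x (y : Ambient d) : ℝ) ^ (2 * p) *
      (inner ℝ u (y : Ambient d) : ℝ) ^ 2 ∂(surface d) =
      ∫ s, s ^ (2 * p + 2) ∂(zonalMeasure d) := by
  set N := 2 * (p + 1) with hN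
  set M : ℝ := ∫ s, s ^ N ∂(zonalMeasure d) with hM
  set I : ℕ → ℝ := fun j => ∫ y : UnitSphere d, (inner ℝ x (y : Ambient d) : ℝ) ^ (N - j) *
      (inner ℝ u (y : Ambient d) : ℝ) ^ j ∂(surface d) with hI
  have key : (∑ j ∈ Finset.range (N + 1), Polynomial.C (I j * N.choose j) * Polynomial.X ^ j :
      Polynomial ℝ) = Polynomial.C M * (1 + Polynomial.X ^ 2) ^ (p + 1) := by
    refine Polynomial.funext fun b => ?_
    simp only [Polynomial.eval_finsetSum, Polynomial.eval_mul, Polynomial.eval_C,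
      Polynomial.eval_pow, Polynomial.eval_X, Polynomial.eval_add, Polynomial.eval_one]
    rw [mul_comm M, hM, ← integral_even_moment_pencil hd h (p + 1) b]
    have hexp : ∀ y : UnitSphere d, ((inner ℝ x (y : Ambient d) : ℝ) +
        b * inner ℝ u (y : Ambient d)) ^ (2 * (p + 1)) =
        ∑ j ∈ Finset.range (N + 1), (N.choose j * b ^ j) *
          ((inner ℝ x (y : Ambient d) : ℝ) ^ (N - j) * (inner ℝ u (y : Ambient d) : ℝ) ^ j) := by
      intro y
      rw [add_comm, add_pow]
      refine Finset.sum_congr rfl fun j _ => ?_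
      rw [hN]
      ring
    simp only [hexp]
    rw [integral_finsetSum]
    · refine Finset.sum_congr rfl fun j _ => ?_
      rw [integral_const_mul]
      simp only [hI]
      ring
    · intro j _
      refine (continuous_integrable_of_compact ?_).const_mul _
      fun_prop
  -- At b² this reads binom(N,2) I₂ = (p+1) M, with binom(N,2) = (p+1)(2p+1) because N = 2(p+1).
  have h2 := congrArg (fun q => Polynomial.coeff q 2) key
  simp only [Polynomial.finsetSum_coeff, Polynomial.coeff_C_mul, Polynomial.coeff_X_pow] at h2
  rw [Finset.sum_eq_single 2] at h2
  rotate_left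
  · intro j _ hj
    simp [hj.symm]
  · intro hj
    exact absurd (Finset.mem_range.2 (by omega)) hj
  have h3 : ((1 + Polynomial.X ^ 2 : Polynomial ℝ) ^ (p + 1)).coeff 2 = p + 1 := by
    have : (1 + Polynomial.X ^ 2 : Polynomial ℝ) ^ (p + 1) =
        Polynomial.expand ℝ 2 ((1 + Polynomial.X) ^ (p + 1)) := by simp
    rw [this]
    have h4 := Polynomial.coeff_expand_mul (R := ℝ) (p := 2) (by norm_num)
      ((1 + Polynomial.X) ^ (p + 1)) 1
    simp only [one_mul] at h4
    rw [h4, Polynomial.coeff_one_add_X_pow]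
    simp
  rw [h3, Nat.cast_choose_two] at h2
  simp only [hI, if_true, mul_one] at h2
  have h5 : N - 2 = 2 * p := by omega
  have h6 : 2 * p + 2 = N := by omega
  rw [h5] at h2
  rw [h6, ← hM]
  have h7 : (N : ℝ) = 2 * (p + 1) := by rw [hN]; push_cast; ring
  rw [h7] at h2
  have h8 : (p + 1 : ℝ) ≠ 0 := by positivity
  apply mul_left_cancel₀ h8
  linarith

/-- Sum the mixed moments over an orthonormal basis that contains the pole: the d other squared
coordinates add up to 1 - s². -/
lemma integral_even_moment_recurrence {d : ℕ} (hd : 1 ≤ d) (p : ℕ) :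
    (2 * p + 1 : ℝ) * (∫ s, s ^ (2 * p) ∂(zonalMeasure d) - ∫ s, s ^ (2 * p + 2) ∂(zonalMeasure d))
      = d * ∫ s, s ^ (2 * p + 2) ∂(zonalMeasure d) := by
  obtain ⟨u, hu⟩ := exists_orthoPair hd (norm_sphere (pole d))
  obtain ⟨b, h0, -⟩ := hu.exists_basis hd
  have hpair : ∀ i : Fin d, OrthoPair (pole d : Ambient d) (b i.succ) := fun i =>
    ⟨norm_sphere _, b.orthonormal.1 _, by
      rw [← h0]; exact b.orthonormal.2 (Fin.succ_ne_zero i).symm⟩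
  have hsum : ∀ y : UnitSphere d, ∑ i : Fin d, (inner ℝ (pole d : Ambient d) (y : Ambient d)) ^ (2 * p)
      * (inner ℝ (b i.succ) (y : Ambient d) : ℝ) ^ 2 =
      (inner ℝ (pole d : Ambient d) (y : Ambient d)) ^ (2 * p) -
      (inner ℝ (pole d : Ambient d) (y : Ambient d)) ^ (2 * p + 2) := by
    intro y
    have h1 := b.sum_sq_norm_inner_right (y : Ambient d)
    rw [Fin.sum_univ_succ, h0] at h1
    simp only [Real.norm_eq_abs, sq_abs, norm_sphere, one_pow] at h1
    rw [← Finset.mul_sum, pow_add, eq_sub_of_add_eq' h1]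
    ring
  have h2 : ∑ i : Fin d, ∫ y : UnitSphere d,
      (inner ℝ (pole d : Ambient d) (y : Ambient d) : ℝ) ^ (2 * p)
      * (inner ℝ (b i.succ) (y : Ambient d) : ℝ) ^ 2 ∂(surface d) =
      ∫ s, s ^ (2 * p) ∂(zonalMeasure d) - ∫ s, s ^ (2 * p + 2) ∂(zonalMeasure d) := by
    rw [← integral_finsetSum]
    · simp only [hsum]
      rw [integral_sub]
      · rw [integral_zonal hd (f := fun s => s ^ (2 * p)) (by fun_prop) (norm_sphere (pole d)),
          integral_zonal hd (f := fun s => s ^ (2 * p + 2)) (by fun_prop) (norm_sphere (pole d))]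
      · exact continuous_integrable_of_compact (by fun_prop)
      · exact continuous_integrable_of_compact (by fun_prop)
    · intro i _
      exact continuous_integrable_of_compact (by fun_prop)
  rw [← h2, Finset.mul_sum, Finset.sum_congr rfl fun i _ => integral_mixed_moment hd (hpair i) p]
  simp

lemma integral_odd_moment {d : ℕ} (hd : 1 ≤ d) {n : ℕ} (hn : Odd n) :
    ∫ s, s ^ n ∂(zonalMeasure d) = 0 := by
  have h1 := integral_zonal hd (f := fun s => s ^ n) (by fun_prop) (norm_sphere (pole d))
  have h2 := integral_zonal hd (f := fun s => s ^ n) (by fun_prop)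
    (x := -(pole d : Ambient d)) (by rw [norm_neg]; exact norm_sphere (pole d))
  simp only [inner_neg_left, hn.neg_pow, integral_neg] at h1 h2
  linarith

lemma integrable_eval_zonalMeasure {d : ℕ} (q : Polynomial ℝ) :
    Integrable (fun s => q.eval s) (zonalMeasure d) :=
  Continuous.integrable_zonalMeasure q.continuous

/-- Integration by parts against the zonal measure. -/
lemma integral_stein {d : ℕ} (hd : 1 ≤ d) (f : Polynomial ℝ) :
    ∫ s, ((1 - Polynomial.X ^ 2) * f.derivative - Polynomial.C (d : ℝ) * Polynomial.X * f).eval s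
      ∂(zonalMeasure d) = 0 := by
  induction f using Polynomial.induction_on' with
  | add p q hp hq =>
    have : ∀ s, ((1 - Polynomial.X ^ 2) * (p + q).derivative -
        Polynomial.C (d : ℝ) * Polynomial.X * (p + q)).eval s =
        ((1 - Polynomial.X ^ 2) * p.derivative - Polynomial.C (d : ℝ) * Polynomial.X * p).eval s +
        ((1 - Polynomial.X ^ 2) * q.derivative - Polynomial.C (d : ℝ) * Polynomial.X * q).eval s := by
      intro s
      simp
      ring
    simp only [this]
    rw [integral_add (integrable_eval_zonalMeasure _) (integrable_eval_zonalMeasure _), hp, hq,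
      add_zero]
  | monomial n a =>
    have hi : ∀ k : ℕ, Integrable (fun s : ℝ => s ^ k) (zonalMeasure d) := fun k =>
      Continuous.integrable_zonalMeasure (by fun_prop)
    have hs : ∀ k l : ℕ, Integrable (fun s : ℝ => s ^ k - s ^ l) (zonalMeasure d) := fun k l =>
      (hi k).sub (hi l)
    have h1 : ∀ s, ((1 - Polynomial.X ^ 2) * (Polynomial.monomial n a).derivative -
        Polynomial.C (d : ℝ) * Polynomial.X * Polynomial.monomial n a).eval s =
        a * (n * (s ^ (n - 1) - s ^ (n - 1 + 2)) - d * s ^ (n + 1)) := by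
      intro s
      simp [Polynomial.derivative_monomial]
      ring
    simp only [h1]
    rw [integral_const_mul, integral_sub ((hs _ _).const_mul _) ((hi _).const_mul _),
      integral_const_mul, integral_sub (hi _) (hi _), integral_const_mul]
    -- For even n only odd moments occur (at n = 0 the truncated n - 1 has coefficient zero). For n
    -- = 2p + 1 the identity is the moment recurrence.
    rcases Nat.even_or_odd n with he | ho
    · rw [integral_odd_moment hd he.add_one]
      rcases Nat.eq_zero_or_pos n with rfl | hp
      · simp
      · have h2 : Odd (n - 1) := by
          obtain ⟨i, hi⟩ := he
          exact ⟨i - 1, by omega⟩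
        rw [integral_odd_moment hd h2, integral_odd_moment hd (h2.add_even even_two)]
        simp
    · obtain ⟨p, rfl⟩ := ho
      have h2 : 2 * p + 1 - 1 = 2 * p := by omega
      have h3 := integral_even_moment_recurrence hd p
      rw [h2]
      push_cast
      rw [h3]
      simp

/-! ### Gegenbauer and Chebyshev polynomials -/

/-- The ultraspherical polynomials as elements of `ℝ[X]`. -/
noncomputable def gegenbauerPoly (lam : ℝ) : ℕ → Polynomial ℝ
  | 0 => 1
  | 1 => Polynomial.C (2 * lam) * Polynomial.X
  | n + 2 => Polynomial.C ((n + 2 : ℝ)⁻¹) *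
      (Polynomial.C (2 * (lam + n + 1)) * Polynomial.X * gegenbauerPoly lam (n + 1) -
        Polynomial.C (2 * lam + n) * gegenbauerPoly lam n)

lemma eval_gegenbauerPoly (lam : ℝ) (n : ℕ) (x : ℝ) :
    (gegenbauerPoly lam n).eval x = gegenbauer lam n x := by
  induction n using Nat.twoStepInduction with
  | zero => simp [gegenbauerPoly, gegenbauer]
  | one => simp [gegenbauerPoly, gegenbauer]
  | more n h0 h1 =>
    simp only [gegenbauerPoly, gegenbauer, Polynomial.eval_mul, Polynomial.eval_sub,
      Polynomial.eval_C, Polynomial.eval_X, h0, h1]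
    field_simp
    ring

lemma gegenbauerPoly_recurrence (lam : ℝ) (n : ℕ) :
    Polynomial.C (n + 2 : ℝ) * gegenbauerPoly lam (n + 2) =
      Polynomial.C (2 * (lam + n + 1)) * Polynomial.X * gegenbauerPoly lam (n + 1) -
        Polynomial.C (2 * lam + n) * gegenbauerPoly lam n := by
  have h : (n + 2 : ℝ) ≠ 0 := by positivity
  rw [gegenbauerPoly, ← mul_assoc, ← Polynomial.C_mul, mul_inv_cancel₀ h, Polynomial.C_1, one_mul]

/-- Both relations are carried through one induction, because the step for each uses the other.
Together they give the differential equation and the values at 1. -/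
lemma gegenbauerPoly_derivative_relations (lam : ℝ) (n : ℕ) :
    (gegenbauerPoly lam (n + 1)).derivative - Polynomial.X * (gegenbauerPoly lam n).derivative =
      Polynomial.C (2 * lam + n) * gegenbauerPoly lam n ∧
    Polynomial.X * (gegenbauerPoly lam (n + 1)).derivative - (gegenbauerPoly lam n).derivative =
      Polynomial.C (n + 1 : ℝ) * gegenbauerPoly lam (n + 1) := by
  induction n with
  | zero => simp [gegenbauerPoly]; ring
  | succ n ih =>
    obtain ⟨hA, hB⟩ := ih
    have hc : Polynomial.C (n + 2 : ℝ) ≠ 0 := by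
      rw [Ne, Polynomial.C_eq_zero]; positivity
    have hrec := gegenbauerPoly_recurrence lam n
    have hder := congrArg Polynomial.derivative hrec
    simp only [Polynomial.derivative_mul, Polynomial.derivative_sub, Polynomial.derivative_C,
      Polynomial.derivative_X, zero_mul, zero_add, mul_one] at hder
    set P0 := gegenbauerPoly lam n
    set P1 := gegenbauerPoly lam (n + 1)
    set P2 := gegenbauerPoly lam (n + 2)
    simp only [map_add, map_mul, Nat.cast_add, Nat.cast_one, Polynomial.C_1, map_natCast,
      Polynomial.C_ofNat] at *
    set L := Polynomial.C lam
    set D0 := Polynomial.derivative P0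
    set D1 := Polynomial.derivative P1
    set D2 := Polynomial.derivative P2
    set X := (Polynomial.X : Polynomial ℝ)
    set N := (n : Polynomial ℝ)
    have h1 : D2 - X * D1 = (2 * L + (N + 1)) * P1 := by
      apply mul_left_cancel₀ hc
      linear_combination hder + (2 * L + N) * hB
    refine ⟨h1, ?_⟩
    linear_combination X * h1 - hrec + X * hB - hA

/-- Differentiating both first-order relations and subtracting X times the second eliminates the
second derivative of the lower polynomial; the second relation itself then removes its first
derivative. -/
lemma gegenbauerPoly_ode (lam : ℝ) (n : ℕ) :
    (1 - Polynomial.X ^ 2) * (gegenbauerPoly lam n).derivative.derivative -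
      Polynomial.C (2 * lam + 1) * Polynomial.X * (gegenbauerPoly lam n).derivative =
      - (Polynomial.C (n * (n + 2 * lam)) * gegenbauerPoly lam n) := by
  rcases n with _ | n
  · simp [gegenbauerPoly]
  · obtain ⟨hA, hB⟩ := gegenbauerPoly_derivative_relations lam n
    have hA' := congrArg Polynomial.derivative hA
    have hB' := congrArg Polynomial.derivative hB
    simp only [Polynomial.derivative_mul, Polynomial.derivative_sub, Polynomial.derivative_C,
      Polynomial.derivative_X, zero_mul, zero_add, one_mul] at hA' hB'
    simp only [map_add, map_mul, Nat.cast_add, Nat.cast_one, Polynomial.C_1, map_natCast,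
      Polynomial.C_ofNat] at *
    linear_combination hA' - Polynomial.X * hB' - (2 * Polynomial.C lam + n + 1) * hB

/-- At x = 1 the two derivative relations have the same left side, so (n+1) P_{n+1}(1) = (2λ+n)
P_n(1). -/
lemma gegenbauerPoly_eval_one_pos {lam : ℝ} (hl : 0 < lam) (n : ℕ) :
    0 < (gegenbauerPoly lam n).eval 1 := by
  induction n with
  | zero => simp [gegenbauerPoly]
  | succ n ih =>
    obtain ⟨hA, hB⟩ := gegenbauerPoly_derivative_relations lam n
    have hA' := congrArg (Polynomial.eval 1) hA
    have hB' := congrArg (Polynomial.eval 1) hB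
    simp only [Polynomial.eval_sub, Polynomial.eval_mul, Polynomial.eval_C, Polynomial.eval_X,
      one_mul] at hA' hB'
    have h1 : (n + 1 : ℝ) * (gegenbauerPoly lam (n + 1)).eval 1 =
        (2 * lam + n) * (gegenbauerPoly lam n).eval 1 := by linarith
    have h2 : 0 < (2 * lam + n) * (gegenbauerPoly lam n).eval 1 := by positivity
    rw [← h1] at h2
    exact pos_of_mul_pos_right h2 (by positivity)

lemma gegenbauerPoly_degree {lam : ℝ} (hl : 0 < lam) (n : ℕ) :
    (gegenbauerPoly lam n).degree = n := by
  induction n using Nat.twoStepInduction with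
  | zero => simp [gegenbauerPoly]
  | one =>
    rw [gegenbauerPoly, Polynomial.degree_C_mul_X (by positivity)]
    rfl
  | more n h0 h1 =>
    have hc : (n + 2 : ℝ)⁻¹ ≠ 0 := by positivity
    have hd1 : (Polynomial.C (2 * (lam + n + 1)) * Polynomial.X * gegenbauerPoly lam (n + 1)).degree
        = ((n + 2 : ℕ) : WithBot ℕ) := by
      rw [Polynomial.degree_mul, Polynomial.degree_C_mul_X (by positivity), h1]
      push_cast
      rw [add_comm, add_assoc]
      norm_num
    rw [gegenbauerPoly, Polynomial.degree_C_mul hc, Polynomial.degree_sub_eq_left_of_degree_lt, hd1]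
    rw [hd1, Polynomial.degree_C_mul (by positivity), h0]
    exact_mod_cast (by omega : n < n + 2)

/-- A polynomial sequence with the properties of the zonal spherical functions of `S^d`. -/
structure IsZonalSequence (d : ℕ) (p : ℕ → Polynomial ℝ) : Prop where
  degree_eq : ∀ n, (p n).degree = n
  ode : ∀ n, (1 - Polynomial.X ^ 2) * (p n).derivative.derivative -
      Polynomial.C (d : ℝ) * Polynomial.X * (p n).derivative =
      - (Polynomial.C (n * (n + (d - 1)) : ℝ) * p n)
  eval_one_pos : ∀ n, 0 < (p n).eval 1

lemma isZonalSequence_gegenbauerPoly {d : ℕ} (hd : 1 < d) :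
    IsZonalSequence d (gegenbauerPoly (((d : ℝ) - 1) / 2)) := by
  have hl : 0 < ((d : ℝ) - 1) / 2 := by
    have : (1 : ℝ) < d := by exact_mod_cast hd
    linarith
  refine ⟨gegenbauerPoly_degree hl, fun n => ?_, gegenbauerPoly_eval_one_pos hl⟩
  have h := gegenbauerPoly_ode (((d : ℝ) - 1) / 2) n
  rwa [mul_div_cancel₀ _ two_ne_zero, sub_add_cancel] at h

lemma isZonalSequence_chebyshev :
    IsZonalSequence 1 fun n => Polynomial.Chebyshev.T ℝ n := by
  refine ⟨fun n => ?_, fun n => ?_, fun n => ?_⟩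
  · rw [Polynomial.Chebyshev.degree_T]; simp
  · have h := Polynomial.Chebyshev.one_sub_X_sq_mul_derivative_derivative_T_eq_poly_in_T
      (R := ℝ) n
    simp only [Function.iterate_succ, Function.iterate_zero, Function.comp, id] at h
    simp only [map_mul, map_add, map_natCast, Nat.cast_one, sub_self, Polynomial.C_1, map_zero]
    rw [h]
    push_cast
    ring
  · simp

/-- For d = 1 the index λ is 0 and the Gegenbauer recurrence degenerates to zero for n ≥ 1;
Chebyshev polynomials take its place, and the rest of the proof treats all d alike. -/
lemma exists_isZonalSequence {d : ℕ} (hd : 1 ≤ d) :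
    ∃ p : ℕ → Polynomial ℝ, IsZonalSequence d p ∧
      ∀ n ϑ, zonal d n ϑ = (p n).eval (Real.cos ϑ) := by
  rcases hd.eq_or_lt with rfl | hd
  · refine ⟨_, isZonalSequence_chebyshev, fun n ϑ => ?_⟩
    rw [Polynomial.Chebyshev.T_real_cos]
    simp [zonal]
  · refine ⟨_, isZonalSequence_gegenbauerPoly hd, fun n ϑ => ?_⟩
    rw [eval_gegenbauerPoly, zonal, if_neg hd.ne']

/-! ### Orthogonality, completeness and Funk–Hecke -/

lemma ae_zonalMeasure_mem_Icc (d : ℕ) : ∀ᵐ s ∂(zonalMeasure d), s ∈ Set.Icc (-1 : ℝ) 1 := by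
  exact (ae_map_iff (p := fun s => s ∈ Set.Icc (-1 : ℝ) 1)
    (continuous_inner_sphere _).aemeasurable measurableSet_Icc).2
    (ae_of_all _ fun y => inner_sphere_mem_Icc _ y)

namespace IsZonalSequence

variable {d : ℕ} {p : ℕ → Polynomial ℝ}

/-- Since p_j has degree exactly j, p_0, …, p_{N-1} span the polynomials of degree below N. -/
lemma integral_mul_eq_zero_of_degree_lt (hp : IsZonalSequence d p) {f : ℝ → ℝ}
    (hf : Continuous f) {N : ℕ}
    (h : ∀ j < N, ∫ s, f s * (p j).eval s ∂(zonalMeasure d) = 0) {q : Polynomial ℝ}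
    (hq : q.degree < N) : ∫ s, f s * q.eval s ∂(zonalMeasure d) = 0 := by
  let S : Polynomial.Sequence ℝ := ⟨p, hp.degree_eq⟩
  have hspan := S.span_degreeLT (m := N) fun i _ =>
    (Polynomial.leadingCoeff_ne_zero.2 (S.ne_zero i)).isUnit
  have hi : ∀ r : Polynomial ℝ, Integrable (fun s => f s * r.eval s) (zonalMeasure d) := fun r =>
    Continuous.integrable_zonalMeasure (hf.mul r.continuous)
  rw [← Polynomial.mem_degreeLT, ← hspan] at hq
  induction hq using Submodule.span_induction with
  | mem r hr =>
    obtain ⟨j, hj, rfl⟩ := hr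
    exact h j hj
  | zero => simp
  | add r t _ _ hr ht =>
    simp only [Polynomial.eval_add, mul_add]
    rw [integral_add (hi r) (hi t), hr, ht, add_zero]
  | smul a r _ hr =>
    simp only [Polynomial.eval_smul, smul_eq_mul, mul_left_comm _ a]
    rw [integral_const_mul, hr, mul_zero]

/-- Integration by parts applied to p_n' p_k. The right side is symmetric in n and k, which
expresses self-adjointness of the differential operator. -/
lemma integral_ode (hd : 1 ≤ d) (hp : IsZonalSequence d p) (n k : ℕ) :
    (n * (n + (d - 1)) : ℝ) * ∫ s, (p n).eval s * (p k).eval s ∂(zonalMeasure d) =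
      ∫ s, ((1 - Polynomial.X ^ 2) * (p n).derivative * (p k).derivative).eval s
        ∂(zonalMeasure d) := by
  have h := integral_stein hd ((p n).derivative * (p k))
  have h1 : ∀ s, ((1 - Polynomial.X ^ 2) * ((p n).derivative * (p k)).derivative -
      Polynomial.C (d : ℝ) * Polynomial.X * ((p n).derivative * (p k))).eval s =
      ((1 - Polynomial.X ^ 2) * (p n).derivative * (p k).derivative).eval s -
        (n * (n + (d - 1)) : ℝ) * ((p n).eval s * (p k).eval s) := by
    intro s
    have h2 := congrArg (Polynomial.eval s) (hp.ode n)
    simp only [Polynomial.eval_sub, Polynomial.eval_mul, Polynomial.eval_neg, Polynomial.eval_C,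
      Polynomial.eval_X, Polynomial.derivative_mul, Polynomial.eval_add, Polynomial.eval_pow,
      Polynomial.eval_one] at h2 ⊢
    linear_combination (p k).eval s * h2
  simp only [h1] at h
  rw [integral_sub (integrable_eval_zonalMeasure _), integral_const_mul] at h
  · linarith
  · exact (Continuous.integrable_zonalMeasure
      ((p n).continuous.mul (p k).continuous)).const_mul _

/-- Eigenfunctions of a self-adjoint operator: the eigenvalues differ by (k-n)(n+k+d-1), which is
nonzero. -/
lemma integral_mul_eq_zero (hd : 1 ≤ d) (hp : IsZonalSequence d p) {n k : ℕ} (hnk : n ≠ k) :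
    ∫ s, (p n).eval s * (p k).eval s ∂(zonalMeasure d) = 0 := by
  have h1 := integral_ode hd hp n k
  have h2 := integral_ode hd hp k n
  simp only [mul_comm ((p k).eval _), mul_right_comm _ (p k).derivative] at h2
  rw [← h1] at h2
  have hd' : (1 : ℝ) ≤ d := by exact_mod_cast hd
  have h3 : ((k : ℝ) - n) * ((n + k + (d - 1)) *
      ∫ s, (p n).eval s * (p k).eval s ∂(zonalMeasure d)) = 0 := by
    linear_combination h2
  have h4 : (k : ℝ) - n ≠ 0 := sub_ne_zero.2 (by exact_mod_cast hnk.symm)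
  have h5 : (n + k + (d - 1) : ℝ) ≠ 0 := by
    have : (1 : ℝ) ≤ n + k := by
      have : 1 ≤ n + k := by omega
      exact_mod_cast this
    linarith
  simpa [h4, h5] using h3

lemma integral_sq_pos (hd : 1 ≤ d) (hp : IsZonalSequence d p) (n : ℕ) :
    0 < ∫ s, (p n).eval s ^ 2 ∂(zonalMeasure d) := by
  refine lt_of_le_of_ne (integral_nonneg fun s => sq_nonneg _) fun h => ?_
  have h1 := forall_eq_zero_of_integral_sq_eq_zero hd (p n).continuous h.symm
    (s := 1) (by simp)
  exact (hp.eval_one_pos n).ne' h1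

/-- A continuous function orthogonal to all zonal polynomials vanishes on `[-1, 1]`. -/
lemma eq_zero_of_forall_integral_eq_zero (hd : 1 ≤ d) (hp : IsZonalSequence d p) {f : ℝ → ℝ}
    (hf : Continuous f) (h : ∀ n, ∫ s, f s * (p n).eval s ∂(zonalMeasure d) = 0) {s : ℝ}
    (hs : s ∈ Set.Icc (-1 : ℝ) 1) : f s = 0 := by
  refine forall_eq_zero_of_integral_sq_eq_zero hd hf ?_ hs
  have hq : ∀ q : Polynomial ℝ, ∫ s, f s * q.eval s ∂(zonalMeasure d) = 0 := fun q =>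
    hp.integral_mul_eq_zero_of_degree_lt hf (fun j _ => h j)
      (q.degree_le_natDegree.trans_lt (by exact_mod_cast Nat.lt_succ_self q.natDegree))
  refine le_antisymm ?_ (integral_nonneg fun s => sq_nonneg _)
  set A := ∫ s, |f s| ∂(zonalMeasure d) with hA
  have hA0 : 0 ≤ A := integral_nonneg fun s => abs_nonneg _
  refine le_of_forall_pos_le_add fun ε hε => ?_
  have hδ : 0 < ε / (A + 1) := by positivity
  obtain ⟨q, hq'⟩ := exists_polynomial_near_of_continuousOn (-1) 1 f hf.continuousOn _ hδ
  calc ∫ s, f s ^ 2 ∂(zonalMeasure d)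
      = ∫ s, (f s * (f s - q.eval s) + f s * q.eval s) ∂(zonalMeasure d) := by
        congr 1; ext s; ring
    _ = ∫ s, f s * (f s - q.eval s) ∂(zonalMeasure d) := by
        rw [integral_add, hq q, add_zero]
        · exact Continuous.integrable_zonalMeasure (hf.mul (hf.sub q.continuous))
        · exact Continuous.integrable_zonalMeasure (hf.mul q.continuous)
    _ ≤ ∫ s, |f s| * (ε / (A + 1)) ∂(zonalMeasure d) := by
        refine integral_mono_ae
          (Continuous.integrable_zonalMeasure (hf.mul (hf.sub q.continuous)))
          ((Continuous.integrable_zonalMeasure hf.abs).mul_const _) ?_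
        filter_upwards [ae_zonalMeasure_mem_Icc d] with s hs
        refine (le_abs_self _).trans ?_
        rw [abs_mul]
        refine mul_le_mul_of_nonneg_left ?_ (abs_nonneg _)
        rw [abs_sub_comm]
        exact (hq' s hs).le
    _ = A * (ε / (A + 1)) := integral_mul_const _ _
    _ ≤ 0 + ε := by
        rw [zero_add, mul_div_assoc', div_le_iff₀ (by positivity)]
        nlinarith

/-- The Funk–Hecke formula. -/
lemma funk_hecke (hd : 1 ≤ d) (hp : IsZonalSequence d p) {φ : ℝ → ℝ} (hφ : Continuous φ) (n : ℕ)
    (x e : UnitSphere d) :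
    ∫ y : UnitSphere d, φ (inner ℝ (x : Ambient d) (y : Ambient d)) *
      (p n).eval (inner ℝ (e : Ambient d) (y : Ambient d)) ∂(surface d) =
      (∫ s, φ s * (p n).eval s ∂(zonalMeasure d)) / (p n).eval 1 *
        (p n).eval (inner ℝ (x : Ambient d) (e : Ambient d)) := by
  choose k hk hint using fun j => exists_polynomial_convolution hd hφ (p j)
  have hnat : ∀ j, (p j).natDegree = j := fun j =>
    Polynomial.natDegree_eq_of_degree_eq_some (hp.degree_eq j)
  have hkdeg : ∀ j, (k j).degree ≤ j := fun j =>
    Polynomial.natDegree_le_iff_degree_le.1 ((hk j).trans_eq (hnat j))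
  -- Convolution with φ is symmetric by Fubini, so ∫ k_n p_j = ∫ p_n k_j, which vanishes because deg
  -- k_j ≤ j < n.
  have hlow : ∀ j < n, ∫ s, (k n).eval s * (p j).eval s ∂(zonalMeasure d) = 0 := by
    intro j hj
    rw [← integral_zonal hd (f := fun s => (k n).eval s * (p j).eval s) (by fun_prop)
      (norm_sphere e)]
    have h1 : ∀ y : UnitSphere d, (k n).eval (inner ℝ (e : Ambient d) (y : Ambient d)) *
        (p j).eval (inner ℝ (e : Ambient d) (y : Ambient d)) =
        ∫ z : UnitSphere d, φ (inner ℝ (y : Ambient d) (z : Ambient d)) *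
          (p n).eval (inner ℝ (e : Ambient d) (z : Ambient d)) *
          (p j).eval (inner ℝ (e : Ambient d) (y : Ambient d)) ∂(surface d) := by
      intro y
      rw [integral_mul_const, hint, real_inner_comm (e : Ambient d)]
    simp only [h1]
    rw [integral_integral_swap]
    · have h2 : ∀ z : UnitSphere d, ∫ y : UnitSphere d,
          φ (inner ℝ (y : Ambient d) (z : Ambient d)) *
          (p n).eval (inner ℝ (e : Ambient d) (z : Ambient d)) *
          (p j).eval (inner ℝ (e : Ambient d) (y : Ambient d)) ∂(surface d) =
          (p n).eval (inner ℝ (e : Ambient d) (z : Ambient d)) *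
          (k j).eval (inner ℝ (e : Ambient d) (z : Ambient d)) := by
        intro z
        rw [real_inner_comm (z : Ambient d) (e : Ambient d), ← hint j z e, ← integral_const_mul]
        congr 1
        ext y
        rw [real_inner_comm (z : Ambient d) (y : Ambient d),
          real_inner_comm (e : Ambient d) (z : Ambient d)]
        ring
      simp only [h2]
      rw [integral_zonal hd (f := fun s => (p n).eval s * (k j).eval s) (by fun_prop)
        (norm_sphere e)]
      refine hp.integral_mul_eq_zero_of_degree_lt (p n).continuous (N := n) (fun i hi => ?_) ?_
      · exact hp.integral_mul_eq_zero hd hi.ne'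
      · exact (hkdeg j).trans_lt (by exact_mod_cast hj)
    · exact continuous_integrable_of_compact (by unfold Function.uncurry; fun_prop)
  have hpos := hp.integral_sq_pos hd n
  set H := ∫ s, (p n).eval s ^ 2 ∂(zonalMeasure d) with hH
  set c := (∫ s, (k n).eval s * (p n).eval s ∂(zonalMeasure d)) / H with hc
  -- Subtracting the projection on p_n leaves a polynomial of degree at most n orthogonal to p_0, …,
  -- p_n, hence to itself.
  set r := k n - Polynomial.C c * p n with hr
  have hrev : ∀ s, r.eval s = (k n).eval s - c * (p n).eval s := fun s => by simp [hr]
  have horth : ∀ j < n + 1, ∫ s, r.eval s * (p j).eval s ∂(zonalMeasure d) = 0 := by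
    intro j hj
    have h1 : ∀ s, r.eval s * (p j).eval s =
        (k n).eval s * (p j).eval s - c * ((p n).eval s * (p j).eval s) := fun s => by
      rw [hrev]; ring
    simp only [h1]
    rw [integral_sub (Continuous.integrable_zonalMeasure (by fun_prop))
      ((Continuous.integrable_zonalMeasure (by fun_prop)).const_mul _), integral_const_mul]
    rcases (Nat.lt_succ_iff.1 hj).eq_or_lt with rfl | hlt
    · simp only [← sq]
      rw [← hH, hc]
      field_simp
      simp
    · rw [hlow j hlt, hp.integral_mul_eq_zero hd hlt.ne']
      simp
  have hrdeg : r.degree < (n + 1 : ℕ) := by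
    have h1 : r.degree ≤ n := by
      refine (Polynomial.degree_sub_le _ _).trans (max_le (hkdeg n) ?_)
      rw [← Polynomial.smul_eq_C_mul]
      exact (Polynomial.degree_smul_le _ _).trans (hp.degree_eq n).le
    exact h1.trans_lt (by exact_mod_cast Nat.lt_succ_self n)
  have hrr := hp.integral_mul_eq_zero_of_degree_lt r.continuous horth hrdeg
  simp only [← sq] at hrr
  have hk_eq : ∀ s ∈ Set.Icc (-1 : ℝ) 1, (k n).eval s = c * (p n).eval s := fun s hs => by
    have := forall_eq_zero_of_integral_sq_eq_zero hd r.continuous hrr hs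
    rw [hrev] at this
    linarith
  -- The eigenvalue c is read off at e = x, where the argument of p_n is 1.
  have h1 := hint n x x
  rw [integral_zonal hd (f := fun s => φ s * (p n).eval s) (by fun_prop) (norm_sphere x),
    real_inner_self_eq_norm_sq, norm_sphere, one_pow, hk_eq 1 (by simp)] at h1
  rw [hint, hk_eq _ (inner_sphere_mem_Icc x e), h1, mul_div_cancel_right₀ _ (hp.eval_one_pos n).ne']

/-- By Funk–Hecke, convolving p_n with itself returns p_n times H / p_n(1), while 2|ab| ≤ a² + b²
bounds the convolution by H. -/
lemma abs_eval_le (hd : 1 ≤ d) (hp : IsZonalSequence d p) (n : ℕ) {s : ℝ}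
    (hs : s ∈ Set.Icc (-1 : ℝ) 1) : |(p n).eval s| ≤ (p n).eval 1 := by
  obtain ⟨z, rfl⟩ := exists_inner_eq hd (pole d) hs
  have h := hp.funk_hecke hd (p n).continuous n (pole d) z
  simp only [← sq] at h
  have hpos := hp.integral_sq_pos hd n
  set H := ∫ s, (p n).eval s ^ 2 ∂(zonalMeasure d) with hH
  have h1 := hp.eval_one_pos n
  have hle : |∫ y : UnitSphere d, (p n).eval (inner ℝ (pole d : Ambient d) (y : Ambient d)) *
      (p n).eval (inner ℝ (z : Ambient d) (y : Ambient d)) ∂(surface d)| ≤ H := by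
    have hi : ∀ x : UnitSphere d, Integrable (fun y : UnitSphere d =>
        (p n).eval (inner ℝ (x : Ambient d) (y : Ambient d)) ^ 2) (surface d) := fun x =>
      continuous_integrable_of_compact (by fun_prop)
    have hx : ∀ x : UnitSphere d, ∫ y : UnitSphere d,
        (p n).eval (inner ℝ (x : Ambient d) (y : Ambient d)) ^ 2 ∂(surface d) = H := fun x =>
      integral_zonal hd (f := fun s => (p n).eval s ^ 2) (by fun_prop) (norm_sphere x)
    calc _ ≤ ∫ y : UnitSphere d, |(p n).eval (inner ℝ (pole d : Ambient d) (y : Ambient d)) *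
          (p n).eval (inner ℝ (z : Ambient d) (y : Ambient d))| ∂(surface d) :=
          abs_integral_le_integral_abs
      _ ≤ ∫ y : UnitSphere d, ((1 / 2 : ℝ) *
            (p n).eval (inner ℝ (pole d : Ambient d) (y : Ambient d)) ^ 2 +
          (1 / 2 : ℝ) * (p n).eval (inner ℝ (z : Ambient d) (y : Ambient d)) ^ 2) ∂(surface d) := by
          refine integral_mono (continuous_integrable_of_compact (by fun_prop))
            (((hi _).const_mul _).add ((hi _).const_mul _)) fun y => ?_
          change |_| ≤ _
          rw [abs_mul]
          have := two_mul_le_add_sq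
            |(p n).eval (inner ℝ (pole d : Ambient d) (y : Ambient d))|
            |(p n).eval (inner ℝ (z : Ambient d) (y : Ambient d))|
          rw [sq_abs, sq_abs] at this
          linarith
      _ = H := by
          rw [integral_add ((hi _).const_mul _) ((hi _).const_mul _), integral_const_mul,
            integral_const_mul, hx, hx]
          ring
  rw [h, abs_mul, abs_of_pos (by positivity), div_mul_eq_mul_div, div_le_iff₀ h1] at hle
  exact le_of_mul_le_mul_left hle hpos

end IsZonalSequence

/-! ### Zonal series -/

/-- The Fourier coefficient of `f` with respect to the zonal polynomial `p n`. -/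
noncomputable def zonalCoeff (d : ℕ) (p : ℕ → Polynomial ℝ) (f : ℝ → ℝ) (n : ℕ) : ℝ :=
  (∫ s, f s * (p n).eval s ∂(zonalMeasure d)) / ∫ s, (p n).eval s ^ 2 ∂(zonalMeasure d)

/-- The weighted spherical mean of an `H`-valued function with zonal weight `p n`. -/
noncomputable def zonalMean {H : Type*} [NormedAddCommGroup H] [NormedSpace ℝ H] {d : ℕ}
    (p : ℕ → Polynomial ℝ) (n : ℕ) (Y : UnitSphere d → H) : H :=
  ∫ x : UnitSphere d, (p n).eval (inner ℝ (pole d : Ambient d) (x : Ambient d)) • Y x ∂(surface d)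

namespace IsZonalSequence

variable {d : ℕ} {p : ℕ → Polynomial ℝ}

/-- A continuous function with absolutely summable zonal coefficients is the sum of its zonal
series. -/
lemma hasSum_zonal (hd : 1 ≤ d) (hp : IsZonalSequence d p) {f : ℝ → ℝ} (hf : Continuous f)
    (hsum : Summable fun n => |zonalCoeff d p f n| * (p n).eval 1) {s : ℝ}
    (hs : s ∈ Set.Icc (-1 : ℝ) 1) :
    HasSum (fun n => zonalCoeff d p f n * (p n).eval s) (f s) := by
  set A := zonalCoeff d p f with hA
  -- Clamping to [-1,1] makes the series converge uniformly on all of ℝ; the zonal measure does not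
  -- see the change.
  set κ : ℝ → ℝ := fun s => max (-1) (min s 1) with hκ
  have hκc : Continuous κ := by fun_prop
  have hκmem : ∀ s, κ s ∈ Set.Icc (-1 : ℝ) 1 := fun s =>
    ⟨le_max_left _ _, max_le (by norm_num) (min_le_right _ _)⟩
  have hκid : ∀ s ∈ Set.Icc (-1 : ℝ) 1, κ s = s := fun s hs => by
    simp only [hκ]; rw [min_eq_left hs.2, max_eq_right hs.1]
  have hbound : ∀ n s, ‖A n * (p n).eval (κ s)‖ ≤ |A n| * (p n).eval 1 := fun n s => by
    rw [norm_mul]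
    exact mul_le_mul_of_nonneg_left (hp.abs_eval_le hd n (hκmem s)) (abs_nonneg _)
  have hcont : ∀ n, Continuous fun s => A n * (p n).eval (κ s) := fun n => by fun_prop
  have hg : Continuous fun s => ∑' n, A n * (p n).eval (κ s) :=
    continuous_tsum hcont hsum hbound
  have hgs : ∀ s, HasSum (fun n => A n * (p n).eval (κ s)) (∑' n, A n * (p n).eval (κ s)) :=
    fun s => (Summable.of_norm_bounded hsum fun n => hbound n s).hasSum
  have key : ∀ k, ∫ s, (∑' n, A n * (p n).eval (κ s)) * (p k).eval s ∂(zonalMeasure d) =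
      ∫ s, f s * (p k).eval s ∂(zonalMeasure d) := by
    intro k
    have hterm : ∀ n, ∫ s, A n * (p n).eval (κ s) * (p k).eval s ∂(zonalMeasure d) =
        if n = k then ∫ s, f s * (p k).eval s ∂(zonalMeasure d) else 0 := by
      intro n
      have h1 : ∫ s, A n * (p n).eval (κ s) * (p k).eval s ∂(zonalMeasure d) =
          ∫ s, A n * ((p n).eval s * (p k).eval s) ∂(zonalMeasure d) := by
        refine integral_congr_ae ?_
        filter_upwards [ae_zonalMeasure_mem_Icc d] with s hs
        rw [hκid s hs, mul_assoc]
      rw [h1, integral_const_mul]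
      split_ifs with h
      · subst h
        simp only [← sq]
        exact div_mul_cancel₀ _ (hp.integral_sq_pos hd n).ne'
      · rw [hp.integral_mul_eq_zero hd h, mul_zero]
    have hint : ∀ n, Integrable (fun s => A n * (p n).eval (κ s) * (p k).eval s)
        (zonalMeasure d) := fun n =>
      Continuous.integrable_zonalMeasure ((hcont n).mul (p k).continuous)
    have hs' : Summable fun n => ∫ s, ‖A n * (p n).eval (κ s) * (p k).eval s‖ ∂(zonalMeasure d) := by
      refine Summable.of_nonneg_of_le (fun n => integral_nonneg fun s => norm_nonneg _)
        (fun n => ?_) (hsum.mul_right (∫ s, ‖(p k).eval s‖ ∂(zonalMeasure d)))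
      rw [← integral_const_mul]
      refine integral_mono (hint n).norm
        ((integrable_eval_zonalMeasure (p k)).norm.const_mul _) fun s => ?_
      simp only [norm_mul]
      rw [← norm_mul]
      exact mul_le_mul_of_nonneg_right (hbound n s) (norm_nonneg _)
    have h2 := hasSum_integral_of_summable_integral_norm hint hs'
    simp only [hterm, tsum_mul_right] at h2
    exact h2.unique (hasSum_ite_eq k _)
  have hzero : ∀ s ∈ Set.Icc (-1 : ℝ) 1, (∑' n, A n * (p n).eval (κ s)) - f s = 0 := by
    intro s hs
    refine hp.eq_zero_of_forall_integral_eq_zero hd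
      (f := fun s => (∑' n, A n * (p n).eval (κ s)) - f s) (hg.sub hf) (fun k => ?_) hs
    simp only [sub_mul]
    rw [integral_sub, key, sub_self]
    · exact Continuous.integrable_zonalMeasure (hg.mul (p k).continuous)
    · exact Continuous.integrable_zonalMeasure (hf.mul (p k).continuous)
  have h3 := hgs s
  rw [sub_eq_zero.1 (hzero s hs)] at h3
  simpa only [hκid s hs] using h3

/-! ### Zonal components of a Hilbert-valued function -/

section Hilbert

variable {H : Type*} [NormedAddCommGroup H] [InnerProductSpace ℝ H]

lemma integrable_zonal_smul {Y : UnitSphere d → H} (hY : Continuous Y) (n : ℕ) :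
    Integrable (fun x : UnitSphere d =>
      (p n).eval (inner ℝ (pole d : Ambient d) (x : Ambient d)) • Y x) (surface d) :=
  continuous_integrable_of_compact (by fun_prop)

variable [CompleteSpace H]

/-- The inner product passes under the Bochner integral, leaving a scalar convolution to which
Funk–Hecke applies. -/
lemma inner_zonalMean_left (hd : 1 ≤ d) (hp : IsZonalSequence d p) {Y Y' : UnitSphere d → H}
    (hY : Continuous Y) {c : ℝ → ℝ} (hc : Continuous c)
    (hYY' : ∀ x y, inner ℝ (Y x) (Y' y) = c (inner ℝ (x : Ambient d) (y : Ambient d)))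
    (n : ℕ) (z : UnitSphere d) :
    inner ℝ (zonalMean p n Y) (Y' z) =
      (∫ s, c s * (p n).eval s ∂(zonalMeasure d)) / (p n).eval 1 *
        (p n).eval (inner ℝ (pole d : Ambient d) (z : Ambient d)) := by
  rw [real_inner_comm, zonalMean, ← integral_inner (integrable_zonal_smul hY n),
    real_inner_comm (z : Ambient d), ← hp.funk_hecke hd hc n z (pole d)]
  congr 1
  ext x
  rw [real_inner_smul_right, real_inner_comm (Y x) (Y' z), hYY', real_inner_comm (z : Ambient d) (x : Ambient d)]
  ring

lemma inner_zonalMean_zonalMean (hd : 1 ≤ d) (hp : IsZonalSequence d p) {Y Y' : UnitSphere d → H}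
    (hY : Continuous Y) (hY' : Continuous Y') {c : ℝ → ℝ} (hc : Continuous c)
    (hYY' : ∀ x y, inner ℝ (Y x) (Y' y) = c (inner ℝ (x : Ambient d) (y : Ambient d)))
    (n k : ℕ) :
    inner ℝ (zonalMean p n Y) (zonalMean p k Y') =
      (∫ s, c s * (p n).eval s ∂(zonalMeasure d)) / (p n).eval 1 *
        ∫ s, (p n).eval s * (p k).eval s ∂(zonalMeasure d) := by
  conv_lhs => rw [zonalMean.eq_def p k, ← integral_inner (integrable_zonal_smul hY' k)]
  simp only [real_inner_smul_right, hp.inner_zonalMean_left hd hY hc hYY']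
  rw [← integral_zonal hd (f := fun s => (p n).eval s * (p k).eval s) (by fun_prop)
    (norm_sphere (pole d)), ← integral_const_mul]
  congr 1
  ext x
  ring

/-- The degree `n` component, normalised so that its Gram matrix consists of the zonal
coefficients. -/
noncomputable def component (d : ℕ) (p : ℕ → Polynomial ℝ) (n : ℕ) (Y : UnitSphere d → H) : H :=
  (√((p n).eval 1) / ∫ s, (p n).eval s ^ 2 ∂(zonalMeasure d)) • zonalMean p n Y

lemma inner_component (hd : 1 ≤ d) (hp : IsZonalSequence d p) {Y Y' : UnitSphere d → H}
    (hY : Continuous Y) (hY' : Continuous Y') {c : ℝ → ℝ} (hc : Continuous c)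
    (hYY' : ∀ x y, inner ℝ (Y x) (Y' y) = c (inner ℝ (x : Ambient d) (y : Ambient d)))
    (n : ℕ) :
    inner ℝ (component d p n Y) (component d p n Y') = zonalCoeff d p c n := by
  rw [component, component, real_inner_smul_left, real_inner_smul_right,
    hp.inner_zonalMean_zonalMean hd hY hY' hc hYY', zonalCoeff]
  simp only [← sq]
  have h1 := (hp.eval_one_pos n)
  have h2 := (hp.integral_sq_pos hd n).ne'
  have h3 := Real.sq_sqrt h1.le
  have h4 := h1.ne'
  field_simp
  rw [h3, mul_comm]

lemma inner_component_ne (hd : 1 ≤ d) (hp : IsZonalSequence d p) {Y : UnitSphere d → H}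
    (hY : Continuous Y) {c : ℝ → ℝ} (hc : Continuous c)
    (hYY : ∀ x y, inner ℝ (Y x) (Y y) = c (inner ℝ (x : Ambient d) (y : Ambient d)))
    {n k : ℕ} (hnk : n ≠ k) :
    inner ℝ (component d p n Y) (component d p k Y) = 0 := by
  rw [component, component, real_inner_smul_left, real_inner_smul_right,
    hp.inner_zonalMean_zonalMean hd hY hY hc hYY, hp.integral_mul_eq_zero hd hnk]
  simp

lemma inner_component_pole (hd : 1 ≤ d) (hp : IsZonalSequence d p) {Y : UnitSphere d → H}
    (hY : Continuous Y) {c : ℝ → ℝ} (hc : Continuous c)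
    (hYY : ∀ x y, inner ℝ (Y x) (Y y) = c (inner ℝ (x : Ambient d) (y : Ambient d)))
    (n : ℕ) :
    inner ℝ (component d p n Y) (Y (pole d)) = √((p n).eval 1) * zonalCoeff d p c n := by
  rw [component, real_inner_smul_left, hp.inner_zonalMean_left hd hY hc hYY,
    real_inner_self_eq_norm_sq, norm_sphere, one_pow, zonalCoeff]
  have h1 := (hp.eval_one_pos n).ne'
  field_simp

/-- Bessel's inequality for the zonal components. -/
lemma summable_zonalCoeff_self (hd : 1 ≤ d) (hp : IsZonalSequence d p) {Y : UnitSphere d → H}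
    (hY : Continuous Y) {c : ℝ → ℝ} (hc : Continuous c)
    (hYY : ∀ x y, inner ℝ (Y x) (Y y) = c (inner ℝ (x : Ambient d) (y : Ambient d))) :
    Summable fun n => zonalCoeff d p c n * (p n).eval 1 := by
  have hW := fun n => hp.inner_component hd hY hY hc hYY n
  refine summable_of_sum_le (c := ‖Y (pole d)‖ ^ 2) (fun n => ?_) fun F => ?_
  · rw [← hW]
    exact mul_nonneg real_inner_self_nonneg (hp.eval_one_pos n).le
  · have h1 : ∀ n, inner ℝ (√((p n).eval 1) • component d p n Y) (Y (pole d)) =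
        zonalCoeff d p c n * (p n).eval 1 := fun n => by
      rw [real_inner_smul_left, hp.inner_component_pole hd hY hc hYY, ← mul_assoc,
        Real.mul_self_sqrt (hp.eval_one_pos n).le, mul_comm]
    have h2 : ‖∑ n ∈ F, √((p n).eval 1) • component d p n Y‖ ^ 2 =
        ∑ n ∈ F, zonalCoeff d p c n * (p n).eval 1 := by
      rw [← real_inner_self_eq_norm_sq, sum_inner]
      refine Finset.sum_congr rfl fun n hn => ?_
      rw [inner_sum, Finset.sum_eq_single_of_mem n hn]
      · rw [real_inner_smul_left, real_inner_smul_right, hW, ← mul_assoc,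
          Real.mul_self_sqrt (hp.eval_one_pos n).le, mul_comm]
      · intro k _ hk
        rw [real_inner_smul_left, real_inner_smul_right,
          hp.inner_component_ne hd hY hc hYY hk.symm, mul_zero, mul_zero]
    -- The sum S satisfies ⟨S, Y(pole)⟩ = ‖S‖² = the partial sum, so 0 ≤ ‖S - Y(pole)‖² bounds that
    -- partial sum by ‖Y(pole)‖².
    have h3 := norm_sub_sq_real (∑ n ∈ F, √((p n).eval 1) • component d p n Y) (Y (pole d))
    rw [sum_inner, Finset.sum_congr rfl fun n _ => h1 n, h2] at h3
    nlinarith [sq_nonneg ‖∑ n ∈ F, √((p n).eval 1) • component d p n Y - Y (pole d)‖]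

/-- The Cauchy–Schwarz inequality transfers summability to cross coefficients. -/
lemma summable_abs_zonalCoeff (hd : 1 ≤ d) (hp : IsZonalSequence d p) {Y Y' : UnitSphere d → H}
    (hY : Continuous Y) (hY' : Continuous Y') {c c₁ c₂ : ℝ → ℝ} (hc : Continuous c)
    (hc₁ : Continuous c₁) (hc₂ : Continuous c₂)
    (hYY' : ∀ x y, inner ℝ (Y x) (Y' y) = c (inner ℝ (x : Ambient d) (y : Ambient d)))
    (hYY : ∀ x y, inner ℝ (Y x) (Y y) = c₁ (inner ℝ (x : Ambient d) (y : Ambient d)))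
    (hYY₂ : ∀ x y, inner ℝ (Y' x) (Y' y) = c₂ (inner ℝ (x : Ambient d) (y : Ambient d))) :
    Summable fun n => |zonalCoeff d p c n| * (p n).eval 1 := by
  refine Summable.of_nonneg_of_le (fun n => ?_) (fun n => ?_)
    ((hp.summable_zonalCoeff_self hd hY hc₁ hYY).add
      (hp.summable_zonalCoeff_self hd hY' hc₂ hYY₂))
  · exact mul_nonneg (abs_nonneg _) (hp.eval_one_pos n).le
  · rw [← add_mul]
    refine mul_le_mul_of_nonneg_right ?_ (hp.eval_one_pos n).le
    rw [← hp.inner_component hd hY hY' hc hYY', ← hp.inner_component hd hY hY hc₁ hYY,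
      ← hp.inner_component hd hY' hY' hc₂ hYY₂, real_inner_self_eq_norm_sq,
      real_inner_self_eq_norm_sq]
    have h1 := abs_real_inner_le_norm (component d p n Y) (component d p n Y')
    nlinarith [two_mul_le_add_sq ‖component d p n Y‖ ‖component d p n Y'‖,
      sq_nonneg ‖component d p n Y‖, sq_nonneg ‖component d p n Y'‖]

end Hilbert

end IsZonalSequence

/-! ### Second-order variables and symmetrisation -/

section SecondOrder

variable {Ω : Type u} [MeasurableSpace Ω] {P : Measure Ω}

lemma inner_toLp_eq_integral {f g : Ω → ℝ} (hf : MemLp f 2 P) (hg : MemLp g 2 P) :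
    inner ℝ (hf.toLp f) (hg.toLp g) = ∫ ω, f ω * g ω ∂P := by
  rw [L2.inner_def]
  refine integral_congr_ae ?_
  filter_upwards [hf.coeFn_toLp, hg.coeFn_toLp] with ω h1 h2
  rw [h1, h2, real_inner_eq_re_inner, RCLike.inner_apply]
  simp [mul_comm]

/-- The two coordinates of the product space are independent, so the cross covariances vanish. -/
lemma covariance_add_prod [IsProbabilityMeasure P] {f g f' g' : Ω → ℝ} (hf : MemLp f 2 P)
    (hg : MemLp g 2 P) (hf' : MemLp f' 2 P) (hg' : MemLp g' 2 P) :
    covariance (fun q : Ω × Ω => f q.1 + g q.2) (fun q => f' q.1 + g' q.2) (P.prod P) =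
      covariance f f' P + covariance g g' P := by
  have h1 : covariance (fun q : Ω × Ω => f q.1) (fun q => f' q.1) (P.prod P) =
      covariance f f' P := by
    have hm : (P.prod P).map Prod.fst = P := measurePreserving_fst.map_eq
    rw [← covariance_map_fun (by rw [hm]; exact hf.1) (by rw [hm]; exact hf'.1)
      measurable_fst.aemeasurable, hm]
  have h2 : covariance (fun q : Ω × Ω => g q.2) (fun q => g' q.2) (P.prod P) =
      covariance g g' P := by
    have hm : (P.prod P).map Prod.snd = P := measurePreserving_snd.map_eq
    rw [← covariance_map_fun (by rw [hm]; exact hg.1) (by rw [hm]; exact hg'.1)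
      measurable_snd.aemeasurable, hm]
  have h3 := covariance_fst_snd_prod hf hg'
  have h4 := covariance_fst_snd_prod hf' hg
  rw [covariance_comm] at h4
  change covariance ((fun q : Ω × Ω => f q.1) + fun q => g q.2)
    ((fun q => f' q.1) + fun q => g' q.2) (P.prod P) = _
  rw [covariance_add_left (hf.comp_fst P) (hg.comp_snd P)
      ((hf'.comp_fst P).add (hg'.comp_snd P)),
    covariance_add_right (hf.comp_fst P) (hf'.comp_fst P) (hg'.comp_snd P),
    covariance_add_right (hg.comp_snd P) (hf'.comp_fst P) (hg'.comp_snd P), h1, h2, h3, h4]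
  ring

/-- The symmetrisation of a stationary covariance function is one, realised by two independent
copies of the process, one of them run backwards. -/
lemma isStationaryCovMatrixFunction_symmetrization [IsProbabilityMeasure P] {T : Type v}
    [AddCommGroup T] {m : ℕ} (w : T → Fin m → Lp ℝ 2 P) (A : T → Matrix (Fin m) (Fin m) ℝ)
    (hmean : ∀ t i, ∫ ω, w t i ω ∂P = 0)
    (hcov : ∀ t s i j, inner ℝ (w t i) (w s j) = A (t - s) i j) :
    IsStationaryCovMatrixFunction.{u, v} fun t => (1 / 2 : ℝ) • (A t + A (-t)) := by
  have hL : ∀ t i, MemLp (w t i) 2 P := fun t i => Lp.memLp _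
  have hcov' : ∀ t s i j, covariance (w t i) (w s j) P = A (t - s) i j := by
    intro t s i j
    rw [← hcov, covariance, hmean, hmean, L2.inner_def]
    simp [mul_comm]
  set r : ℝ := (√2)⁻¹ with hr
  have hrr : r * r = 1 / 2 := by
    rw [hr, ← mul_inv, Real.mul_self_sqrt zero_le_two, one_div]
  have hsum : ∀ t i, MemLp (fun q : Ω × Ω => w t i q.1 + w (-t) i q.2) 2 (P.prod P) :=
    fun t i => ((hL t i).comp_fst P).add ((hL (-t) i).comp_snd P)
  refine ⟨Ω × Ω, inferInstance, P.prod P, inferInstance,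
    fun t q => WithLp.toLp 2 fun i => r * (w t i q.1 + w (-t) i q.2), fun t => ⟨?_, ?_⟩,
    ⟨0, fun t => ?_⟩, fun t s => ?_⟩
  · refine (WithLp.measurable_toLp 2 _).comp (measurable_pi_lambda _ fun i => ?_)
    refine Measurable.const_mul (Measurable.add ?_ ?_) r
    · exact (Lp.stronglyMeasurable _).measurable.comp measurable_fst
    · exact (Lp.stronglyMeasurable _).measurable.comp measurable_snd
  · exact MemLp.of_eval_piLp fun i => (hsum t i).const_mul r
  · ext i
    rw [eval_integral_piLp fun i => ((hsum t i).const_mul r).integrable (by simp)]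
    simp only [PiLp.zero_apply]
    rw [integral_const_mul, integral_add
      (((hL t i).comp_fst P).integrable (by simp)) (((hL (-t) i).comp_snd P).integrable (by simp)),
      integral_fun_fst (f := w t i), integral_fun_snd (f := w (-t) i), hmean, hmean]
    simp
  · ext i j
    simp only [covMatrix, Matrix.of_apply]
    rw [covariance_const_mul_left, covariance_const_mul_right,
      covariance_add_prod (hL _ _) (hL _ _) (hL _ _) (hL _ _), hcov', hcov', ← mul_assoc, hrr,
      neg_sub_neg, Matrix.smul_apply, Matrix.add_apply, neg_sub, smul_eq_mul]

end SecondOrder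

/-! ### The random field as a continuous L²-valued map -/

section Field

variable {Ω : Type u} [MeasurableSpace Ω] {P : Measure Ω}
  {T : Type v} [AddCommGroup T] {d m : ℕ} {Z : UnitSphere d → T → Ω → EuclideanSpace ℝ (Fin m)}

namespace IsIsotropicStationary

lemma memLp_coord (hZ : IsIsotropicStationary P Z) (x : UnitSphere d) (t : T) (i : Fin m) :
    MemLp (fun ω => Z x t ω i) 2 P := (hZ.secondOrder x t).2.eval_piLp i

variable [IsProbabilityMeasure P]

lemma memLp_centred (hZ : IsIsotropicStationary P Z) (x : UnitSphere d) (t : T) (i : Fin m) :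
    MemLp (fun ω => Z x t ω i - ∫ ω, Z x t ω i ∂P) 2 P :=
  (hZ.memLp_coord x t i).sub (memLp_const _)

/-- The centred `i`-th coordinate of the field at time `t`, as an `L²`-valued function. -/
noncomputable def centred (hZ : IsIsotropicStationary P Z) (t : T) (i : Fin m)
    (x : UnitSphere d) : Lp ℝ 2 P :=
  (hZ.memLp_centred x t i).toLp _

lemma inner_centred (hZ : IsIsotropicStationary P Z) (x y : UnitSphere d) (t s : T)
    (i j : Fin m) :
    inner ℝ (hZ.centred t i x) (hZ.centred s j y) = covMatrix P (Z x t) (Z y s) i j := by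
  rw [centred, centred, inner_toLp_eq_integral]
  rfl

lemma integral_coord_eq (hZ : IsIsotropicStationary P Z) (x y : UnitSphere d) (t : T)
    (i : Fin m) : ∫ ω, Z x t ω i ∂P = ∫ ω, Z y t ω i ∂P := by
  obtain ⟨μ, hμ⟩ := hZ.mean_const
  have h : ∀ x, ∫ ω, Z x t ω i ∂P = μ i := fun x => by
    rw [← hμ x t, eval_integral_piLp fun i => (hZ.memLp_coord x t i).integrable (by simp)]
  rw [h, h]

/-- The constant mean cancels in differences, and a coordinate is bounded by the norm. -/
lemma continuous_centred (hZ : IsIsotropicStationary P Z)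
    (hcont : IsMeanSquareContinuousOnSphere P Z) (t : T) (i : Fin m) :
    Continuous (hZ.centred t i) := by
  refine continuous_iff_continuousAt.2 fun x₀ => ?_
  rw [ContinuousAt, tendsto_iff_norm_sub_tendsto_zero]
  have hsq : Tendsto (fun x => √(∫ ω, ‖Z x t ω - Z x₀ t ω‖ ^ 2 ∂P)) (𝓝 x₀) (𝓝 0) := by
    simpa using (hcont t x₀).sqrt
  refine squeeze_zero (fun x => norm_nonneg _) (fun x => ?_) hsq
  refine Real.le_sqrt_of_sq_le ?_
  rw [centred, centred, ← MemLp.toLp_sub, ← real_inner_self_eq_norm_sq, inner_toLp_eq_integral]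
  refine integral_mono_of_nonneg (ae_of_all _ fun ω => mul_self_nonneg _) ?_
    (ae_of_all _ fun ω => ?_)
  · exact ((hZ.secondOrder x t).2.sub (hZ.secondOrder x₀ t).2).integrable_norm_pow (by norm_num)
  · simp only [Pi.sub_apply]
    rw [hZ.integral_coord_eq x x₀, sub_sub_sub_cancel_right, ← sq, ← sq_abs]
    refine pow_le_pow_left₀ (abs_nonneg _) ?_ 2
    exact PiLp.norm_apply_le (Z x t ω - Z x₀ t ω) i

/-- Expectation is the inner product with the constant 1, so it commutes with the spherical average
of mean-zero variables. -/
lemma integral_component_centred (hZ : IsIsotropicStationary P Z)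
    (hcont : IsMeanSquareContinuousOnSphere P Z) (p : ℕ → Polynomial ℝ) (n : ℕ) (t : T)
    (i : Fin m) :
    ∫ ω, (IsZonalSequence.component d p n (hZ.centred t i) : Lp ℝ 2 P) ω ∂P = 0 := by
  have h1 : MemLp (fun _ : Ω => (1 : ℝ)) 2 P := memLp_const 1
  have hone : ∀ f : Lp ℝ 2 P, ∫ ω, f ω ∂P = inner ℝ (h1.toLp _) f := fun f => by
    conv_rhs => rw [← Lp.toLp_coeFn f (Lp.memLp f)]
    rw [inner_toLp_eq_integral]
    simp
  rw [hone, IsZonalSequence.component, real_inner_smul_right, zonalMean,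
    ← integral_inner (IsZonalSequence.integrable_zonal_smul (hZ.continuous_centred hcont t i) n)]
  have h2 : ∀ x, inner ℝ (h1.toLp _) (hZ.centred t i x) = (0 : ℝ) := fun x => by
    rw [centred, inner_toLp_eq_integral]
    simp only [one_mul]
    rw [integral_sub ((hZ.memLp_coord x t i).integrable (by simp)) (integrable_const _)]
    simp
  simp only [real_inner_smul_right, h2, mul_zero, integral_zero]

end IsIsotropicStationary

variable [IsProbabilityMeasure P]

/-- A half great circle from the pole. As `Real.arccos` is constant outside [-1,1], the curve is
defined and continuous on all of ℝ. -/
lemma exists_continuous_meridian {d : ℕ} (hd : 1 ≤ d) :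
    ∃ γ : ℝ → UnitSphere d, Continuous γ ∧
      ∀ s, sphericalDist (pole d) (γ s) = Real.arccos s := by
  obtain ⟨u, hu⟩ := exists_orthoPair hd (norm_sphere (pole d))
  have hn : ∀ s, ‖Real.cos (Real.arccos s) • (pole d : Ambient d) +
      Real.sin (Real.arccos s) • u‖ = 1 := by
    intro s
    rw [← sq_eq_sq₀ (norm_nonneg _) zero_le_one, norm_add_sq_real, norm_smul, norm_smul,
      real_inner_smul_left, real_inner_smul_right, hu.ortho, hu.left, hu.right]
    simp
  refine ⟨fun s => ⟨_, mem_sphere_zero_iff_norm.2 (hn s)⟩, ?_, fun s => ?_⟩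
  · refine Continuous.subtype_mk ?_ _
    exact ((Real.continuous_cos.comp Real.continuous_arccos).smul continuous_const).add
      ((Real.continuous_sin.comp Real.continuous_arccos).smul continuous_const)
  · rw [sphericalDist]
    simp only [inner_add_right, real_inner_smul_right, hu.ortho, real_inner_self_eq_norm_sq,
      hu.left]
    rw [mul_zero, add_zero, one_pow, mul_one,
      Real.arccos_cos (Real.arccos_nonneg s) (Real.arccos_le_pi s)]

lemma sphericalDist_comm {d : ℕ} (x y : UnitSphere d) : sphericalDist x y = sphericalDist y x := by
  rw [sphericalDist, sphericalDist, real_inner_comm]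

variable {C : ℝ → T → Matrix (Fin m) (Fin m) ℝ}

lemma IsCovMatrixFunction.inner_centred (hC : IsCovMatrixFunction P Z C)
    (hZ : IsIsotropicStationary P Z) (x y : UnitSphere d) (t s : T) (i j : Fin m) :
    inner ℝ (hZ.centred t i x) (hZ.centred s j y) =
      C (Real.arccos (inner ℝ (x : Ambient d) (y : Ambient d))) (t - s) i j := by
  rw [hZ.inner_centred, hC]
  rfl

/-- Along a meridian this is the inner product of a fixed vector with a continuous curve. -/
lemma IsCovMatrixFunction.continuous_arccos (hd : 1 ≤ d) (hC : IsCovMatrixFunction P Z C)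
    (hZ : IsIsotropicStationary P Z) (hcont : IsMeanSquareContinuousOnSphere P Z) (t : T)
    (i j : Fin m) : Continuous fun s => C (Real.arccos s) t i j := by
  obtain ⟨γ, hγ, hdist⟩ := exists_continuous_meridian hd
  have h : ∀ s, C (Real.arccos s) t i j =
      inner ℝ (hZ.centred t i (pole d)) (hZ.centred 0 j (γ s)) := fun s => by
    rw [hZ.inner_centred, hC, hdist, sub_zero]
  simp only [h]
  exact continuous_const.inner ((hZ.continuous_centred hcont 0 j).comp hγ)

/-- Swapping the two space-time points reverses the lag but keeps the distance. This is where the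
symmetry of B_n comes from. -/
lemma IsCovMatrixFunction.neg_apply (hd : 1 ≤ d) (hC : IsCovMatrixFunction P Z C)
    (hZ : IsIsotropicStationary P Z) (t : T) (i j : Fin m) (s : ℝ) :
    C (Real.arccos s) (-t) i j = C (Real.arccos s) t j i := by
  obtain ⟨γ, -, hdist⟩ := exists_continuous_meridian hd
  have h1 := hC (pole d) (γ s) 0 t
  have h2 := hC (γ s) (pole d) t 0
  rw [hdist, zero_sub] at h1
  rw [sphericalDist_comm, hdist, sub_zero] at h2
  rw [← h1, ← h2, ← hZ.inner_centred, ← hZ.inner_centred, real_inner_comm]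

end Field

/-! ### Assembly -/

theorem theorem1 {Ω : Type u} [MeasurableSpace Ω] (P : Measure Ω) [IsProbabilityMeasure P]
    {T : Type v} [AddCommGroup T] {d m : ℕ} (hd : 1 ≤ d)
    (Z : UnitSphere d → T → Ω → EuclideanSpace ℝ (Fin m))
    (hZ : IsIsotropicStationary P Z)
    (hcont : IsMeanSquareContinuousOnSphere P Z)
    (C : ℝ → T → Matrix (Fin m) (Fin m) ℝ)
    (hC : IsCovMatrixFunction P Z C) :
    ∃ B : ℕ → T → Matrix (Fin m) (Fin m) ℝ,
      (∀ t, ∀ ϑ ∈ Set.Icc 0 Real.pi,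
        HasSum (fun n => zonal d n ϑ • B n t) ((1 / 2 : ℝ) • (C ϑ t + C ϑ (-t)))) ∧
      (∀ t n, (B n t).IsSymm) ∧
      (∀ t, Summable fun n => zonal d n 0 • B n t) ∧
      (∀ n, IsStationaryCovMatrixFunction.{u, v} (B n)) ∧
      ((∀ ϑ ∈ Set.Icc 0 Real.pi, ∀ t, C ϑ (-t) = C ϑ t) →
        ∀ t, ∀ ϑ ∈ Set.Icc 0 Real.pi, HasSum (fun n => zonal d n ϑ • B n t) (C ϑ t)) := by
  obtain ⟨p, hp, hzonal⟩ := exists_isZonalSequence hd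
  have hcC : ∀ t i j, Continuous fun s => C (Real.arccos s) t i j :=
    hC.continuous_arccos hd hZ hcont
  have hY := hZ.continuous_centred hcont
  set A : ℕ → T → Matrix (Fin m) (Fin m) ℝ := fun n t =>
    Matrix.of fun i j => zonalCoeff d p (fun s => C (Real.arccos s) t i j) n with hA
  have hsumm : ∀ t i j, Summable fun n =>
      |zonalCoeff d p (fun s => C (Real.arccos s) t i j) n| * (p n).eval 1 := by
    intro t i j
    -- The lag t is realised by the times t and 0; both diagonal comparison functions then have lag
    -- 0.
    refine hp.summable_abs_zonalCoeff hd (hY t i) (hY 0 j) (hcC t i j) (hcC 0 i i) (hcC 0 j j)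
      (fun x y => ?_) (fun x y => ?_) (fun x y => ?_)
    · rw [hC.inner_centred hZ, sub_zero]
    · rw [hC.inner_centred hZ, sub_self]
    · rw [hC.inner_centred hZ, sub_self]
  -- The expansion already holds for C itself; symmetrisation serves only to make the coefficients
  -- symmetric matrices.
  have hAsum : ∀ t, ∀ ϑ ∈ Set.Icc 0 Real.pi,
      HasSum (fun n => zonal d n ϑ • A n t) (C ϑ t) := by
    intro t ϑ hϑ
    refine Pi.hasSum.2 fun i => Pi.hasSum.2 fun j => ?_
    have h := hp.hasSum_zonal hd (hcC t i j) (hsumm t i j) (s := Real.cos ϑ)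
      ⟨Real.neg_one_le_cos _, Real.cos_le_one _⟩
    rw [Real.arccos_cos hϑ.1 hϑ.2] at h
    simpa only [hA, hzonal, Matrix.smul_apply, Matrix.of_apply, smul_eq_mul, mul_comm] using h
  have hBsum : ∀ t, ∀ ϑ ∈ Set.Icc 0 Real.pi,
      HasSum (fun n => zonal d n ϑ • ((1 / 2 : ℝ) • (A n t + A n (-t))))
        ((1 / 2 : ℝ) • (C ϑ t + C ϑ (-t))) := by
    intro t ϑ hϑ
    have h := ((hAsum t ϑ hϑ).add (hAsum (-t) ϑ hϑ)).const_smul (1 / 2 : ℝ)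
    have e : ∀ n, zonal d n ϑ • ((1 / 2 : ℝ) • (A n t + A n (-t))) =
        (1 / 2 : ℝ) • (zonal d n ϑ • A n t + zonal d n ϑ • A n (-t)) := fun n => by
      rw [smul_comm, smul_add]
    simp only [e]
    exact h
  refine ⟨fun n t => (1 / 2 : ℝ) • (A n t + A n (-t)), hBsum, fun t n => ?_, fun t => ?_,
    fun n => ?_, fun heven t ϑ hϑ => ?_⟩
  · ext i j
    simp only [hA, Matrix.transpose_apply, Matrix.smul_apply, Matrix.add_apply, Matrix.of_apply,
      hC.neg_apply hd hZ]
    rw [add_comm]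
  · exact (hBsum t 0 ⟨le_rfl, Real.pi_pos.le⟩).summable
  · refine isStationaryCovMatrixFunction_symmetrization
      (fun t i => IsZonalSequence.component d p n (hZ.centred t i)) (A n)
      (fun t i => hZ.integral_component_centred hcont p n t i) fun t s i j => ?_
    exact hp.inner_component hd (hY t i) (hY s j) (hcC (t - s) i j)
      (fun x y => hC.inner_centred hZ x y t s i j) n
  · have h := hBsum t ϑ hϑ
    have e : (1 / 2 : ℝ) • (C ϑ t + C ϑ t) = C ϑ t := by
      rw [← two_smul ℝ, smul_smul]
      norm_num
    rwa [heven ϑ hϑ, e] at h
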